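/- For a positive integer $n$, a plane increasing tree on $[n]=\{1,\dots,n\}$ is a rooted plane tree whose vertices are bijectively labelled by $[n]$ so that each vertex has a larger label than its parent, the children of each vertex being linearly ordered. Let $T_n$ be chosen uniformly at random among all such trees. The rank of a vertex $v$ is the number of edges in the shortest path from $v$ to a leaf that is a descendant of $v$ (so leaves have rank $0$). For $k\ge 0$ let $b_k(n)$ be the number of plane increasing trees on $[n]$ whose root has rank $k$, let $B_k(z)=\sum_{n\ge1} b_k(n)\frac{z^n}{n!}$ for $|z|<1/2$, and set $$c_k := 2\int_0^{1/2}\sqrt{1-2\xi}\;B_k'(\xi)\,d\xi .$$ Theorem. Let $\mathbf k=(k_1,\dots,k_r)$ be a fixed $r$-tuple of non-negative integers, and let $X_{\mathbf k}(n)$ be the number of ordered $r$-tuples $(v_1,\dots,v_r)$ of distinct vertices of $T_n$ such that $v_j$ has rank $k_j$ for $j=1,\dots,r$. Then $$\mathbb E[X_{\mathbf k}(n)] = \bigl(1+O(n^{-1})\bigr)\, n^r \prod_{j=1}^r c_{k_j}\qquad (n\to\infty),$$ where the constant implied by the $O$-term may depend on $\mathbf k$. -/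

import Mathlib

/-- A rooted plane tree whose vertices carry natural numbers as labels: a root together with the
(possibly empty) ordered list of the subtrees rooted at the children of the root. -/
inductive PlaneTree : Type
  | node (label : ℕ) (children : List PlaneTree) : PlaneTree

namespace PlaneTree

/-- The label of the root. -/
def root : PlaneTree → ℕ
  | node a _ => a

mutual
/-- The list of the labels of all vertices of a tree. -/
def labels : PlaneTree → List ℕ
  | node a ts => a :: forestLabels ts
/-- The list of the labels of all vertices of an ordered forest. -/
def forestLabels : List PlaneTree → List ℕ
  | [] => []
  | t :: ts => labels t ++ forestLabels ts
end

/-- Every vertex has a larger label than its parent. -/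
inductive IsIncreasing : PlaneTree → Prop
  | node (a : ℕ) (ts : List PlaneTree) (hlt : ∀ t ∈ ts, a < t.root)
      (hts : ∀ t ∈ ts, IsIncreasing t) : IsIncreasing (.node a ts)

/-- `T.IsSubtree s`: `s` is the subtree of `T` that consists of some vertex of `T` and all
descendants of that vertex. -/
inductive IsSubtree : PlaneTree → PlaneTree → Prop
  | self (t : PlaneTree) : IsSubtree t t
  | child (a : ℕ) (ts : List PlaneTree) (t s : PlaneTree) (ht : t ∈ ts) (hs : IsSubtree t s) :
      IsSubtree (.node a ts) s

/-- `T.HasLeafAtDepth d`: some path that descends from the root of `T`, from a vertex to one of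
its children at each step, reaches a leaf (a vertex without children) after exactly `d` edges. -/
inductive HasLeafAtDepth : PlaneTree → ℕ → Prop
  | leaf (a : ℕ) : HasLeafAtDepth (.node a []) 0
  | child (a : ℕ) (ts : List PlaneTree) (t : PlaneTree) (d : ℕ) (ht : t ∈ ts)
      (hd : HasLeafAtDepth t d) : HasLeafAtDepth (.node a ts) (d + 1)

/-- The rank of the root of `T`: the number of edges in the shortest path from the root to a leaf.
(The set is never empty.) -/
noncomputable def rootRank (T : PlaneTree) : ℕ := sInf {d | T.HasLeafAtDepth d}

/-- The vertex of `T` labelled `v` has rank `k`: the shortest path from it to a leaf that is one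
of its descendants has `k` edges. -/
def HasRank (T : PlaneTree) (v k : ℕ) : Prop :=
  ∃ s, T.IsSubtree s ∧ s.root = v ∧ s.rootRank = k

/-- The number `X_𝐤(T)` of ordered `r`-tuples `(v_1, …, v_r)` of distinct vertices of `T` such
that `v_i` has rank `k_i` for every `i`. Vertices are identified with their labels, so this is
meant for trees in which distinct vertices have distinct labels. -/
noncomputable def tupleCount (T : PlaneTree) {r : ℕ} (k : Fin r → ℕ) : ℕ :=
  Nat.card {v : Fin r ↪ {x : ℕ // x ∈ T.labels} // ∀ i, T.HasRank (v i) (k i)}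

/-- The plane increasing trees on the vertex set `[n] = {1, …, n}`: each element of `[n]` labels
exactly one vertex, and labels increase from parent to child. -/
def increasingTreeSet (n : ℕ) : Set PlaneTree :=
  {T | T.IsIncreasing ∧ T.labels.Nodup ∧ T.labels.toFinset = Finset.Icc 1 n}

theorem finite_forests_of_length_le (S : Finset ℕ) (m : ℕ) :
    {ts : List PlaneTree | (∀ x ∈ forestLabels ts, x ∈ S) ∧
      (forestLabels ts).length ≤ m}.Finite := by
  induction m with
  | zero =>
    refine (Set.finite_singleton ([] : List PlaneTree)).subset ?_
    rintro (_ | ⟨⟨a, cs⟩, ts⟩) ⟨_, h⟩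
    · rfl
    · simp [forestLabels, labels] at h
  | succ m ih =>
    refine ((Set.finite_singleton ([] : List PlaneTree)).union
      (((S.finite_toSet).prod (ih.prod ih)).image
        (fun p : ℕ × List PlaneTree × List PlaneTree => node p.1 p.2.1 :: p.2.2))).subset ?_
    rintro (_ | ⟨⟨a, cs⟩, ts⟩) ⟨hS, h⟩
    · exact Or.inl rfl
    · simp only [forestLabels, labels, List.cons_append, List.length_cons,
        List.length_append, List.mem_cons, List.mem_append] at hS h
      exact Or.inr ⟨(a, cs, ts), ⟨hS a (Or.inl rfl),
        ⟨fun x hx => hS x (Or.inr (Or.inl hx)), by dsimp only; omega⟩,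
        ⟨fun x hx => hS x (Or.inr (Or.inr hx)), by dsimp only; omega⟩⟩, rfl⟩

theorem finite_increasingTreeSet (n : ℕ) : (increasingTreeSet n).Finite := by
  refine Set.Finite.of_finite_image (f := fun T => [T])
    ((finite_forests_of_length_le (Finset.Icc 1 n) n).subset ?_)
    (fun _ _ _ _ h => by simpa using h)
  rintro _ ⟨T, ⟨_, hnd, hl⟩, rfl⟩
  have hlen : T.labels.length = n := by
    rw [← List.toFinset_card_of_nodup hnd, hl]; simp
  simp only [forestLabels, List.append_nil, Set.mem_ofPred_eq]
  exact ⟨fun x hx => by rw [← hl]; simpa using hx, hlen.le⟩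

/-- The finite set of all plane increasing trees on `[n]`. -/
noncomputable def increasingTrees (n : ℕ) : Finset PlaneTree :=
  (finite_increasingTreeSet n).toFinset

/-- The expectation `𝔼[X_𝐤(n)]` of `X_𝐤(T_n)`, where `T_n` is chosen uniformly at random from the
plane increasing trees on `[n]` (meaningful for `n ≥ 1`). -/
noncomputable def expectedTupleCount (n : ℕ) {r : ℕ} (k : Fin r → ℕ) : ℝ :=
  (∑ T ∈ increasingTrees n, (T.tupleCount k : ℝ)) / ((increasingTrees n).card : ℝ)

/-- The number `b_k(n)` of plane increasing trees on `[n]` whose root has rank `k`. -/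
noncomputable def rootRankCount (k n : ℕ) : ℕ :=
  Nat.card {T : PlaneTree // T ∈ increasingTrees n ∧ T.rootRank = k}

/-- The exponential generating function `B_k(x) = ∑ b_k(n) x^n / n!` (convergent for `|x| < 1/2`;
`b_k(0) = 0`). -/
noncomputable def rootRankEGF (k : ℕ) (x : ℝ) : ℝ :=
  ∑' n : ℕ, (rootRankCount k n : ℝ) * x ^ n / (n.factorial : ℝ)

/-- The constant `c_k = 2 ∫_0^{1/2} √(1 - 2ξ) B_k'(ξ) dξ`. -/
noncomputable def rankConst (k : ℕ) : ℝ :=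
  2 * ∫ ξ in (0 : ℝ)..(1 / 2), √(1 - 2 * ξ) * deriv (rootRankEGF k) ξ

end PlaneTree

-- Removing the root of a uniform plane increasing tree on n + 1 vertices leaves an ordered forest
-- with n vertices, and this forest grows as a Markov chain: the largest label sits at a leaf, and a
-- forest with n vertices offers 2n + 1 places for a new leaf. Uniform averages over trees thus
-- become `growthMean` of functions of unlabelled forests (`sum_increasingTrees`).
--
-- Mean. Apart from the root, the number of vertices of rank k is a sum over vertices of an
-- indicator of the forest below. By `growthMean_additive` its mean is a sum of the root-rank
-- probabilities p_m with weights (2n + 1) / ((2m + 1)(2m + 3)), the expected number of non-root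
-- vertices with m proper descendants. A Beta integral identifies c_k with 2 ∑ p_m / ((2m + 1)(2m +
-- 3)) (`hasSum_rankConst`), whose tail is O(1/n). So the mean is c_k n + O(1).
--
-- Variance. Exchanging two pieces of a forest affects "rank at most k" only at the nearest k + 1
-- ancestors of the hole, so the rank count is `SwapBounded`. Averaging over the next insertion
-- preserves this property, and the property bounds the conditional variance of each growth step. So
-- the variance is O(n) (`SwapBounded.growthMean_sq_le`).
--
-- Moments. Each factor of a product of rank counts is c_k n plus a deviation. Deviations have mean
-- O(1) and second moment O(n), which gives n^r ∏ c_{k_j} + O(n^{r-1}) for the mean of the product.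
-- Passing to tuples of distinct vertices costs another O(n^{r-1}), and c_k > 0 turns the absolute
-- error into a relative one.

-- Random growth of plane forests by leaf insertion

/-- Unlabelled ordered forests of plane trees, given by the forest of the children of the first
root and the forest of the remaining trees. Adding a root turns a forest into a plane tree. -/
inductive PlaneForest : Type
  | nil : PlaneForest
  | cons (c r : PlaneForest) : PlaneForest

namespace PlaneForest

/-- The number of vertices. -/
def size : PlaneForest → ℕ
  | nil => 0
  | cons c r => size c + size r + 1

/-- Concatenation of forests. -/
def append : PlaneForest → PlaneForest → PlaneForest
  | nil, y => y
  | cons c r, y => cons c (append r y)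

@[simp] theorem size_append (x y : PlaneForest) : (append x y).size = x.size + y.size := by
  induction x with
  | nil => simp [append, size]
  | cons c r _ ih => simp only [append, size, ih]; omega

/-- The sum of `f` over all forests that arise from a forest by inserting a new leaf, except for
the insertion as the first root. -/
def innerSum : (PlaneForest → ℝ) → PlaneForest → ℝ
  | _, nil => 0
  | f, cons c r =>
      (f (cons (cons nil c) r) + innerSum (fun x => f (cons x r)) c) +
        (f (cons c (cons nil r)) + innerSum (fun x => f (cons c x)) r)

/-- The sum of `f` over all forests that arise from a forest by inserting a new leaf. -/
def insSum (f : PlaneForest → ℝ) (F : PlaneForest) : ℝ := f (cons nil F) + innerSum f F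

theorem innerSum_cons (f : PlaneForest → ℝ) (c r : PlaneForest) :
    innerSum f (cons c r) =
      insSum (fun x => f (cons x r)) c + insSum (fun x => f (cons c x)) r := rfl

theorem innerSum_add (f g : PlaneForest → ℝ) (F : PlaneForest) :
    innerSum (fun x => f x + g x) F = innerSum f F + innerSum g F := by
  induction F generalizing f g with
  | nil => simp [innerSum]
  | cons c r ihc ihr => simp only [innerSum, ihc, ihr]; ring

theorem innerSum_mul_left (a : ℝ) (f : PlaneForest → ℝ) (F : PlaneForest) :
    innerSum (fun x => a * f x) F = a * innerSum f F := by
  induction F generalizing f with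
  | nil => simp [innerSum]
  | cons c r ihc ihr => simp only [innerSum, ihc, ihr]; ring

theorem innerSum_const (a : ℝ) (F : PlaneForest) :
    innerSum (fun _ => a) F = 2 * F.size * a := by
  induction F with
  | nil => simp [innerSum, size]
  | cons c r ihc ihr => simp only [innerSum, ihc, ihr, size]; push_cast; ring

theorem innerSum_mono {f g : PlaneForest → ℝ} {F : PlaneForest}
    (h : ∀ x, x.size = F.size + 1 → f x ≤ g x) : innerSum f F ≤ innerSum g F := by
  induction F generalizing f g with
  | nil => simp [innerSum]
  | cons c r ihc ihr =>
    simp only [innerSum]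
    refine add_le_add (add_le_add (h _ ?_) (ihc fun x hx => h _ ?_))
      (add_le_add (h _ ?_) (ihr fun x hx => h _ ?_)) <;> simp only [size] at * <;> omega

theorem insSum_add (f g : PlaneForest → ℝ) (F : PlaneForest) :
    insSum (fun x => f x + g x) F = insSum f F + insSum g F := by
  simp only [insSum, innerSum_add]; ring

theorem insSum_mul_left (a : ℝ) (f : PlaneForest → ℝ) (F : PlaneForest) :
    insSum (fun x => a * f x) F = a * insSum f F := by
  simp only [insSum, innerSum_mul_left]; ring

theorem insSum_const (a : ℝ) (F : PlaneForest) :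
    insSum (fun _ => a) F = (2 * F.size + 1) * a := by
  simp only [insSum, innerSum_const]; ring

theorem insSum_mono {f g : PlaneForest → ℝ} {F : PlaneForest}
    (h : ∀ x, x.size = F.size + 1 → f x ≤ g x) : insSum f F ≤ insSum g F :=
  add_le_add (h _ (by simp [size])) (innerSum_mono h)

/-- The end of `x` and the front of `y` are the same place. It is counted with `x`, so `y`
contributes only its inner places. -/
theorem insSum_append (f : PlaneForest → ℝ) (x y : PlaneForest) :
    insSum f (append x y) =
      insSum (fun z => f (append z y)) x + innerSum (fun z => f (append x z)) y := by
  induction x generalizing f with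
  | nil => simp [append, insSum, innerSum]
  | cons c r _ ih =>
    simp only [append]
    rw [insSum, innerSum_cons, ih, insSum.eq_1 _ (cons c r), innerSum_cons]
    simp only [append]
    ring

/-- The mean of `f` after the insertion of a leaf at a uniformly random position. -/
noncomputable def insMean (f : PlaneForest → ℝ) (F : PlaneForest) : ℝ :=
  insSum f F / (2 * F.size + 1)

theorem insSum_eq (f : PlaneForest → ℝ) (F : PlaneForest) :
    insSum f F = (2 * F.size + 1) * insMean f F := by
  rw [insMean, mul_div_cancel₀]; positivity

/-- The mean of `f` after `n` successive insertions of a leaf at uniformly random positions,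
starting from the empty forest. -/
noncomputable def growthMean : ℕ → (PlaneForest → ℝ) → ℝ
  | 0, f => f nil
  | n + 1, f => growthMean n (insMean f)

theorem growthMean_mono {n : ℕ} {f g : PlaneForest → ℝ} (h : ∀ x, x.size = n → f x ≤ g x) :
    growthMean n f ≤ growthMean n g := by
  induction n generalizing f g with
  | zero => exact h _ rfl
  | succ n ih =>
    refine ih fun x hx => ?_
    exact div_le_div_of_nonneg_right (insSum_mono fun y hy => h y (by omega)) (by positivity)

theorem growthMean_congr {n : ℕ} {f g : PlaneForest → ℝ} (h : ∀ x, x.size = n → f x = g x) :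
    growthMean n f = growthMean n g :=
  le_antisymm (growthMean_mono fun x hx => (h x hx).le) (growthMean_mono fun x hx => (h x hx).ge)

theorem insMean_add (f g : PlaneForest → ℝ) :
    insMean (fun x => f x + g x) = fun x => insMean f x + insMean g x := by
  funext x; simp only [insMean, insSum_add, add_div]

theorem insMean_mul_left (a : ℝ) (f : PlaneForest → ℝ) :
    insMean (fun x => a * f x) = fun x => a * insMean f x := by
  funext x; simp only [insMean, insSum_mul_left, mul_div_assoc]

theorem insMean_const (a : ℝ) : insMean (fun _ => a) = fun _ => a := by
  funext x; rw [insMean, insSum_const, mul_div_cancel_left₀]; positivity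

theorem growthMean_add (n : ℕ) (f g : PlaneForest → ℝ) :
    growthMean n (fun x => f x + g x) = growthMean n f + growthMean n g := by
  induction n generalizing f g with
  | zero => rfl
  | succ n ih => simp only [growthMean, insMean_add, ih]

theorem growthMean_mul_left (n : ℕ) (a : ℝ) (f : PlaneForest → ℝ) :
    growthMean n (fun x => a * f x) = a * growthMean n f := by
  induction n generalizing f with
  | zero => rfl
  | succ n ih => simp only [growthMean, insMean_mul_left, ih]

theorem growthMean_const (n : ℕ) (a : ℝ) : growthMean n (fun _ => a) = a := by
  induction n with
  | zero => rfl
  | succ n ih => simp only [growthMean, insMean_const, ih]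

theorem growthMean_nonneg {n : ℕ} {f : PlaneForest → ℝ} (h : ∀ x, 0 ≤ f x) :
    0 ≤ growthMean n f := by
  rw [← growthMean_const n 0]; exact growthMean_mono fun x _ => h x

theorem abs_growthMean_le (n : ℕ) (f : PlaneForest → ℝ) :
    |growthMean n f| ≤ growthMean n (fun x => |f x|) := by
  refine abs_le.2 ⟨?_, growthMean_mono fun x _ => le_abs_self _⟩
  have h := growthMean_mul_left n (-1) (fun x => |f x|)
  rw [← neg_one_mul, ← h]
  exact growthMean_mono fun x _ => by linarith [neg_abs_le (f x)]

/-! ### Additive functionals -/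

/-- The sum over all vertices of `φ`, applied to the forest of descendants of the vertex. -/
def additive (φ : PlaneForest → ℝ) : PlaneForest → ℝ
  | nil => 0
  | cons c r => φ c + additive φ c + additive φ r

theorem additive_add (φ ψ : PlaneForest → ℝ) (F : PlaneForest) :
    additive (fun x => φ x + ψ x) F = additive φ F + additive ψ F := by
  induction F with
  | nil => simp [additive]
  | cons c r ihc ihr => simp only [additive, ihc, ihr]; ring

theorem additive_mul_left (a : ℝ) (φ : PlaneForest → ℝ) (F : PlaneForest) :
    additive (fun x => a * φ x) F = a * additive φ F := by
  induction F with
  | nil => simp [additive]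
  | cons c r ihc ihr => simp only [additive, ihc, ihr]; ring

theorem additive_append (φ : PlaneForest → ℝ) (x y : PlaneForest) :
    additive φ (append x y) = additive φ x + additive φ y := by
  induction x with
  | nil => simp [append, additive]
  | cons c r _ ih => simp only [append, additive, ih]; ring

/-- The forest `c` below a given vertex receives the new leaf at 2|c| + 1 of the 2|F| + 1 places and
is unchanged at the others; the leaf itself contributes `φ nil`. -/
theorem insSum_additive (φ : PlaneForest → ℝ) (F : PlaneForest) :
    insSum (additive φ) F =
      additive (fun c => insSum φ c + -(2 * c.size + 1) * φ c) F +
        (2 * F.size + 1) * (additive φ F + φ nil) := by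
  induction F with
  | nil => simp [insSum, innerSum, additive, size]
  | cons c r ihc ihr =>
    rw [insSum, innerSum_cons]
    simp only [additive, insSum_add, insSum_const, ihc, ihr, size]
    push_cast
    ring

/-- The mean of an additive functional. -/
theorem growthMean_additive (n : ℕ) (φ : PlaneForest → ℝ) :
    growthMean n (additive φ) = (2 * n + 1) *
      ∑ m ∈ Finset.range n, growthMean m φ / ((2 * m + 1) * (2 * m + 3)) := by
  induction n generalizing φ with
  | zero => simp [growthMean, additive]
  | succ n ih =>
    have h1 : growthMean n (insMean (additive φ)) =
        growthMean n (fun x => (2 * n + 1 : ℝ)⁻¹ *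
          additive (fun c => (insSum φ c + -(2 * c.size + 1) * φ c) + (2 * n + 1) * φ c) x
            + φ nil) := by
      refine growthMean_congr fun x hx => ?_
      have : (2 * n + 1 : ℝ) ≠ 0 := by positivity
      rw [insMean, insSum_additive, hx,
        additive_add (fun c => insSum φ c + -(2 * c.size + 1) * φ c), additive_mul_left]
      field_simp
      ring
    have h2 : ∀ m, growthMean m
        (fun c => (insSum φ c + -(2 * c.size + 1) * φ c) + (2 * n + 1) * φ c) =
        (2 * m + 1) * growthMean (m + 1) φ + (2 * n - 2 * m) * growthMean m φ := by
      intro m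
      rw [growthMean, ← growthMean_mul_left, ← growthMean_mul_left, ← growthMean_add]
      refine growthMean_congr fun x hx => ?_
      rw [insSum_eq, hx]; ring
    rw [growthMean, h1, growthMean_add, growthMean_mul_left, growthMean_const, ih]
    simp only [h2]
    have h0 : (2 * n + 1 : ℝ) ≠ 0 := by positivity
    rw [← mul_assoc, inv_mul_cancel₀ h0, one_mul]
    -- Summation by parts. The weights keep `n` fixed while the range `N` varies, so that induction
    -- on `N` applies; the case `N = n` is used.
    have h3 : ∀ N : ℕ, ∑ m ∈ Finset.range N, ((2 * m + 1 : ℝ) * growthMean (m + 1) φ +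
        (2 * n - 2 * m) * growthMean m φ) / ((2 * m + 1) * (2 * m + 3)) + φ nil =
        (2 * n + 3) * (∑ m ∈ Finset.range N, growthMean m φ / ((2 * m + 1) * (2 * m + 3))) +
        growthMean N φ / (2 * N + 1) := by
      intro N
      induction N with
      | zero => simp [growthMean]
      | succ N ihN =>
        rw [Finset.sum_range_succ, Finset.sum_range_succ, add_right_comm, ihN]
        push_cast
        field_simp
        ring
    rw [h3, Finset.sum_range_succ]
    push_cast
    field_simp
    ring

/-! ### Forests with a hole -/

/-- Forests with a hole, which stands between two consecutive siblings. -/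
inductive Ctx : Type
  | here (x : PlaneForest) : Ctx
  | left (c : Ctx) (r : PlaneForest) : Ctx
  | right (c : PlaneForest) (r : Ctx) : Ctx

namespace Ctx

/-- The forest that arises by filling the hole. -/
def fill : Ctx → PlaneForest → PlaneForest
  | here x, F => append F x
  | left c r, F => cons (fill c F) r
  | right c r, F => cons c (fill r F)

/-- The hole does not come first. -/
def Proper : Ctx → Prop
  | here _ => False
  | _ => True

/-- The depth of the hole. -/
def depth : Ctx → ℕ
  | here _ => 0
  | left c _ => depth c + 1
  | right _ r => depth r

/-- The number of vertices. -/
def size : Ctx → ℕ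
  | here x => x.size
  | left c r => size c + r.size + 1
  | right c r => c.size + size r + 1

@[simp] theorem size_fill (C : Ctx) (F : PlaneForest) : (C.fill F).size = C.size + F.size := by
  induction C with
  | here x => simp [fill, size, add_comm]
  | left c r ih => simp only [fill, size, PlaneForest.size, ih]; omega
  | right c r ih => simp only [fill, size, PlaneForest.size, ih]; omega

/-- The value of `g` at the insertion of a leaf in front, unless this happens in the hole. -/
def frontVal (g : Ctx → ℝ) : Ctx → ℝ
  | here _ => 0
  | C => g (right nil C)

/-- The sum of `g` over the insertions of a leaf neither in front nor in the hole. -/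
def innerSum : (Ctx → ℝ) → Ctx → ℝ
  | g, here x => PlaneForest.innerSum (fun y => g (here y)) x
  | g, left c r => frontVal (fun x => g (left x r)) c + innerSum (fun x => g (left x r)) c +
      insSum (fun x => g (left c x)) r
  | g, right c r => insSum (fun x => g (right x r)) c +
      (frontVal (fun x => g (right c x)) r + innerSum (fun x => g (right c x)) r)

/-- The places in the filled forest are those of `F`, both of its ends included, and those outside.
If the hole comes first, the front place belongs to `F`, which is why `frontVal` vanishes there. -/
theorem insSum_fill (f : PlaneForest → ℝ) (C : Ctx) (F : PlaneForest) :
    insSum f (C.fill F) = insSum (fun x => f (C.fill x)) F +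
      (frontVal (fun D => f (D.fill F)) C + innerSum (fun D => f (D.fill F)) C) := by
  induction C generalizing f with
  | here x => simp only [fill, frontVal, innerSum, insSum_append, zero_add]
  | left c r ih =>
    simp only [fill]
    rw [insSum, innerSum_cons, ih]
    simp only [frontVal, innerSum, fill]
    ring
  | right c r ih =>
    simp only [fill]
    rw [insSum, innerSum_cons, ih]
    simp only [frontVal, innerSum, fill]
    ring

/-- The front place of `C.fill F` is the end of `G` and is counted there. As the hole does not come
first, it is not also a place of `F`. -/
theorem insSum_append_fill (f : PlaneForest → ℝ) {C : Ctx} (hC : C.Proper) (F G : PlaneForest) :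
    insSum f (append G (C.fill F)) = insSum (fun x => f (append x (C.fill F))) G +
      insSum (fun x => f (append G (C.fill x))) F +
      innerSum (fun D => f (append G (D.fill F))) C := by
  rw [insSum_append]
  have h := insSum_fill (fun x => f (append G x)) C F
  rw [insSum] at h
  cases C with
  | here x => exact hC.elim
  | left c r => simp only [frontVal, fill] at h ⊢; linarith
  | right c r => simp only [frontVal, fill] at h ⊢; linarith

theorem frontVal_mono {g h : Ctx → ℝ} (H : ∀ D, g D ≤ h D) (C : Ctx) :
    frontVal g C ≤ frontVal h C := by
  cases C with
  | here x => exact le_rfl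
  | left c r => exact H _
  | right c r => exact H _

theorem innerSum_mono {g h : Ctx → ℝ} (H : ∀ D, g D ≤ h D) (C : Ctx) :
    innerSum g C ≤ innerSum h C := by
  induction C generalizing g h with
  | here x => exact PlaneForest.innerSum_mono fun y _ => H _
  | left c r ih =>
    exact add_le_add (add_le_add (frontVal_mono (fun _ => H _) c) (ih fun _ => H _))
      (insSum_mono fun y _ => H _)
  | right c r ih =>
    exact add_le_add (insSum_mono fun y _ => H _)
      (add_le_add (frontVal_mono (fun _ => H _) r) (ih fun _ => H _))

theorem innerSum_mono_of_proper {g h : Ctx → ℝ} (H : ∀ D, D.Proper → g D ≤ h D) {C : Ctx}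
    (hC : C.Proper) : innerSum g C ≤ innerSum h C := by
  cases C with
  | here x => exact hC.elim
  | left c r =>
    exact add_le_add (add_le_add (frontVal_mono (fun D => H (left D r) trivial) c)
      (innerSum_mono (fun D => H (left D r) trivial) c)) (insSum_mono fun y _ => H _ trivial)
  | right c r =>
    exact add_le_add (insSum_mono fun y _ => H _ trivial)
      (add_le_add (frontVal_mono (fun D => H (right c D) trivial) r)
        (innerSum_mono (fun D => H (right c D) trivial) r))

theorem frontVal_add (g h : Ctx → ℝ) (C : Ctx) :
    frontVal (fun D => g D + h D) C = frontVal g C + frontVal h C := by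
  cases C <;> simp [frontVal]

theorem innerSum_add (g h : Ctx → ℝ) (C : Ctx) :
    innerSum (fun D => g D + h D) C = innerSum g C + innerSum h C := by
  induction C generalizing g h with
  | here x => exact PlaneForest.innerSum_add _ _ _
  | left c r ih => simp only [innerSum, frontVal_add, ih, insSum_add]; ring
  | right c r ih => simp only [innerSum, frontVal_add, ih, insSum_add]; ring

end Ctx

/-! ### The variance of functionals with bounded differences -/

/-- The functional `f` increases by at most `K` when the first trees are exchanged with a
sequence of consecutive siblings elsewhere in the forest. -/
def SwapBounded (f : PlaneForest → ℝ) (K : ℝ) : Prop :=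
  ∀ (C : Ctx), C.Proper → ∀ F G : PlaneForest,
    f (append G (C.fill F)) ≤ f (append F (C.fill G)) + K

/-- Coupling: a leaf inserted into one of the exchanged pieces travels with that piece, and a leaf
inserted elsewhere stays in the context. This matches the places of the two forests, and every
matched pair again differs by an exchange. -/
theorem SwapBounded.insMean {f : PlaneForest → ℝ} {K : ℝ} (hf : SwapBounded f K) :
    SwapBounded (insMean f) K := by
  intro C hC F G
  have key : insSum f (append G (C.fill F)) ≤
      insSum f (append F (C.fill G)) + insSum (fun _ => K) (append F (C.fill G)) := by
    rw [Ctx.insSum_append_fill f hC F G, Ctx.insSum_append_fill f hC G F,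
      Ctx.insSum_append_fill (fun _ => K) hC G F]
    have h1 := insSum_mono (F := G) (f := fun x => f (append x (C.fill F)))
      (g := fun x => f (append F (C.fill x)) + K) fun x _ => hf C hC F x
    have h2 := insSum_mono (F := F) (f := fun x => f (append G (C.fill x)))
      (g := fun x => f (append x (C.fill G)) + K) fun x _ => hf C hC x G
    have h3 := Ctx.innerSum_mono_of_proper (g := fun D => f (append G (D.fill F)))
      (h := fun D => f (append F (D.fill G)) + K) (fun D hD => hf D hD F G) hC
    rw [insSum_add] at h1 h2
    rw [Ctx.innerSum_add] at h3
    linarith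
  rw [insSum_const] at key
  have hs : (append G (C.fill F)).size = (append F (C.fill G)).size := by simp; omega
  have hpos : (0 : ℝ) < 2 * (append F (C.fill G)).size + 1 := by positivity
  rw [PlaneForest.insMean, PlaneForest.insMean, hs, div_le_iff₀ hpos, add_mul,
    div_mul_cancel₀ _ hpos.ne']
  linarith

/-- Each of the 2|F| places other than the front is a proper context whose hole is empty. -/
theorem innerSum_le_of_ctx {f : PlaneForest → ℝ} {K : ℝ} {F : PlaneForest}
    (h : ∀ C : Ctx, C.Proper → C.fill nil = F → f (C.fill (cons nil nil)) ≤ K) :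
    innerSum f F ≤ 2 * F.size * K := by
  induction F generalizing f with
  | nil => simp [innerSum, size]
  | cons c r ihc ihr =>
    have h1 := ihc (f := fun x => f (cons x r)) fun C _ hC2 =>
      h (.left C r) trivial (by simp only [Ctx.fill, hC2])
    have h2 := ihr (f := fun x => f (cons c x)) fun C _ hC2 =>
      h (.right c C) trivial (by simp only [Ctx.fill, hC2])
    have h3 := h (.left (.here c) r) trivial rfl
    have h4 := h (.right c (.here r)) trivial rfl
    simp only [Ctx.fill, append] at h3 h4
    simp only [innerSum, size]
    push_cast
    linarith

/-- Exchanging the empty forest with a single leaf moves the new leaf from the front to any other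
place. All values thus lie within `K` of the value `a` at the front, and the variance is at most the
mean square distance from `a`. -/
theorem SwapBounded.insMean_sq_le {f : PlaneForest → ℝ} {K : ℝ} (hf : SwapBounded f K)
    (F : PlaneForest) :
    PlaneForest.insMean (fun x => f x ^ 2) F ≤ PlaneForest.insMean f F ^ 2 + K ^ 2 := by
  set a := f (cons nil F) with ha
  have h1 : PlaneForest.insMean (fun x => (f x - a) ^ 2) F ≤ K ^ 2 := by
    rw [PlaneForest.insMean, div_le_iff₀ (by positivity), insSum]
    have := innerSum_le_of_ctx (f := fun x => (f x - a) ^ 2) (K := K ^ 2) (F := F) ?_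
    · simp only [← ha, sub_self]; nlinarith [sq_nonneg K]
    · intro C hC hCF
      have e1 := hf C hC nil (cons nil nil)
      have e2 := hf C hC (cons nil nil) nil
      simp only [append, hCF, ← ha] at e1 e2
      exact sq_le_sq' (by linarith) (by linarith)
  have h2 : (fun x => (f x - a) ^ 2) = fun x => (f x ^ 2 + (-2 * a) * f x) + a ^ 2 := by
    funext x; ring
  rw [h2, insMean_add, insMean_add, insMean_mul_left, insMean_const] at h1
  nlinarith [sq_nonneg (PlaneForest.insMean f F - a)]

/-- The variance of a functional with bounded differences grows at most linearly. -/
theorem SwapBounded.growthMean_sq_le {f : PlaneForest → ℝ} {K : ℝ} (hf : SwapBounded f K)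
    (n : ℕ) : growthMean n (fun x => f x ^ 2) ≤ growthMean n f ^ 2 + n * K ^ 2 := by
  induction n generalizing f with
  | zero => simp [growthMean]
  | succ n ih =>
    -- Decomposition of the variance: `insMean f` is swap bounded with the same `K`, and the last
    -- insertion adds a conditional variance of at most `K ^ 2`.
    have h1 := ih hf.insMean
    have h2 : growthMean n (PlaneForest.insMean fun x => f x ^ 2) ≤
        growthMean n (fun x => PlaneForest.insMean f x ^ 2 + K ^ 2) :=
      growthMean_mono fun x _ => hf.insMean_sq_le x
    rw [growthMean_add, growthMean_const] at h2
    simp only [growthMean]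
    push_cast
    linarith

/-! ### Ranks -/

/-- The rank of a vertex, as a function of the forest of its descendants. -/
def rank : PlaneForest → ℕ
  | nil => 0
  | cons c nil => rank c + 1
  | cons c r => min (rank c + 1) (rank r)

theorem rank_cons_of_ne (c : PlaneForest) {r : PlaneForest} (hr : r ≠ nil) :
    rank (cons c r) = min (rank c + 1) (rank r) := by
  cases r with
  | nil => exact absurd rfl hr
  | cons a b => rw [rank]; simp

theorem rank_cons_nil (c : PlaneForest) : rank (cons c nil) = rank c + 1 := by rw [rank]

theorem rank_pos {F : PlaneForest} (h : F ≠ nil) : 0 < rank F := by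
  induction F with
  | nil => exact absurd rfl h
  | cons c r _ ih =>
    by_cases hr : r = nil
    · subst hr; rw [rank_cons_nil]; omega
    · rw [rank_cons_of_ne c hr]; have := ih hr; omega

/-- Seen from the vertex above the whole forest, the parent of the hole is at distance `C.depth`.
What fills the hole can therefore create or destroy leaves only at distance at least `C.depth`,
beyond `k`. -/
theorem Ctx.rank_fill_le_iff {C : Ctx} {k : ℕ} (h : k < C.depth) (F G : PlaneForest) :
    rank (C.fill F) ≤ k ↔ rank (C.fill G) ≤ k := by
  induction C generalizing k with
  | here x => simp [Ctx.depth] at h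
  | left c r ih =>
    simp only [Ctx.fill, Ctx.depth] at *
    cases k with
    | zero =>
      have h1 := rank_pos (F := cons (c.fill F) r) (by simp)
      have h2 := rank_pos (F := cons (c.fill G) r) (by simp)
      omega
    | succ k =>
      have := ih (k := k) (by omega)
      by_cases hr : r = nil
      · subst hr; rw [rank_cons_nil, rank_cons_nil]; omega
      · rw [rank_cons_of_ne _ hr, rank_cons_of_ne _ hr]; omega
  | right c r ih =>
    -- A hole of positive depth lies below some root of `r`, so `r` stays nonempty under every
    -- filling and the `min` branch of `rank` applies.
    have hne : ∀ H, r.fill H ≠ nil := by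
      cases r with
      | here x => simp [Ctx.depth] at h
      | left _ _ => simp [Ctx.fill]
      | right _ _ => simp [Ctx.fill]
    have := ih (k := k) h
    simp only [Ctx.fill, rank_cons_of_ne c (hne _)]
    omega

/-- The indicator function of the forests below a vertex of rank at most `k`. -/
def rankLe (k : ℕ) (F : PlaneForest) : ℝ := if rank F ≤ k then 1 else 0

/-- The indicator function of the forests below a vertex of rank `k`. -/
def rankEq (k : ℕ) (F : PlaneForest) : ℝ := if rank F = k then 1 else 0

/-- Once the contributions of the pieces themselves are subtracted, only the `C.depth` ancestors of
the hole can differ, and by `Ctx.rank_fill_le_iff` only the nearest k + 1 of them do. -/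
theorem additive_rankLe_fill_le (k : ℕ) (C : Ctx) (F G : PlaneForest) :
    additive (rankLe k) (C.fill F) - additive (rankLe k) F ≤
      additive (rankLe k) (C.fill G) - additive (rankLe k) G + min C.depth (k + 1) := by
  induction C with
  | here x => simp only [Ctx.fill, additive_append, Ctx.depth]; simp
  | left c r ih =>
    simp only [Ctx.fill, additive, Ctx.depth]
    by_cases hk : k < c.depth
    · have h1 : rankLe k (c.fill F) = rankLe k (c.fill G) := by
        simp only [rankLe, Ctx.rank_fill_le_iff hk F G]
      rw [h1]
      rw [min_eq_right (by omega)] at ih ⊢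
      linarith
    · have h1 : rankLe k (c.fill F) ≤ rankLe k (c.fill G) + 1 := by
        simp only [rankLe]; split_ifs <;> norm_num
      rw [min_eq_left (by omega)] at ih ⊢
      push_cast
      linarith
  | right c r ih =>
    simp only [Ctx.fill, additive, Ctx.depth] at *
    linarith

theorem swapBounded_additive_rankLe (k : ℕ) : SwapBounded (additive (rankLe k)) (k + 1) := by
  intro C _ F G
  have h := additive_rankLe_fill_le k C F G
  have h2 : ((min C.depth (k + 1) : ℕ) : ℝ) ≤ k + 1 := by
    exact_mod_cast min_le_right _ _
  simp only [additive_append]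
  linarith

theorem swapBounded_additive_rankEq (k : ℕ) :
    SwapBounded (additive (rankEq k)) (2 * k + 1) := by
  cases k with
  | zero =>
    have : rankEq 0 = rankLe 0 := by funext x; simp [rankEq, rankLe]
    rw [this]
    simpa using swapBounded_additive_rankLe 0
  | succ k =>
    -- The constants k + 2 and k + 1 of the two counts add up. The subtracted count needs the
    -- reverse exchange, hence the swapped `G F` below.
    have h1 : rankEq (k + 1) = fun x => rankLe (k + 1) x + (-1) * rankLe k x := by
      funext x; simp only [rankEq, rankLe]; split_ifs <;> first | omega | norm_num
    intro C hC F G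
    have e1 := swapBounded_additive_rankLe (k + 1) C hC F G
    have e2 := swapBounded_additive_rankLe k C hC G F
    simp only [h1, additive_add, additive_mul_left]
    push_cast at *
    linarith

/-- The path with `k` vertices. -/
def path : ℕ → PlaneForest
  | 0 => nil
  | k + 1 => cons (path k) nil

theorem rank_path (k : ℕ) : rank (path k) = k := by
  induction k with
  | zero => rfl
  | succ k ih => rw [path, rank_cons_nil, ih]

theorem insSum_nonneg {f : PlaneForest → ℝ} (hf : ∀ x, 0 ≤ f x) (F : PlaneForest) :
    0 ≤ insSum f F := by
  have h := insSum_mono (F := F) (f := fun _ => 0) (g := f) fun x _ => hf x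
  simpa [insSum_const] using h

/-- A leaf inserted below the last vertex lengthens the path. Hence paths occur with positive
probability, which is what makes `rankConst k` positive. -/
theorem le_insSum_path {f : PlaneForest → ℝ} (hf : ∀ x, 0 ≤ f x) (k : ℕ) :
    f (path (k + 1)) ≤ insSum f (path k) := by
  induction k generalizing f with
  | zero => simp [path, insSum, innerSum]
  | succ k ih =>
    have h1 := ih (f := fun x => f (cons x nil)) fun x => hf _
    have h2 := insSum_nonneg (f := fun x => f (cons (path k) x)) (fun x => hf _) nil
    have h3 := hf (cons nil (path (k + 1)))
    rw [path, insSum, path, innerSum_cons]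
    simp only [path] at h1 h3 ⊢
    linarith

theorem growthMean_pos {f : PlaneForest → ℝ} (hf : ∀ x, 0 ≤ f x) {k : ℕ}
    (hk : 0 < f (path k)) : 0 < growthMean k f := by
  induction k generalizing f with
  | zero => exact hk
  | succ k ih =>
    refine ih (fun x => div_nonneg (insSum_nonneg hf x) (by positivity)) ?_
    exact div_pos (hk.trans_le (le_insSum_path hf k)) (by positivity)

theorem rankEq_nonneg (k : ℕ) (F : PlaneForest) : 0 ≤ rankEq k F := by
  unfold rankEq; split_ifs <;> norm_num

theorem rankEq_le_one (k : ℕ) (F : PlaneForest) : rankEq k F ≤ 1 := by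
  unfold rankEq; split_ifs <;> norm_num

theorem additive_nonneg {φ : PlaneForest → ℝ} (h : ∀ x, 0 ≤ φ x) (F : PlaneForest) :
    0 ≤ additive φ F := by
  induction F with
  | nil => simp [additive]
  | cons c r ihc ihr => simp only [additive]; linarith [h c]

theorem additive_le_size {φ : PlaneForest → ℝ} (h : ∀ x, φ x ≤ 1) (F : PlaneForest) :
    additive φ F ≤ F.size := by
  induction F with
  | nil => simp [additive, size]
  | cons c r ihc ihr => simp only [additive, size]; push_cast; linarith [h c]

/-- The probability that the root of a random plane increasing tree on `n + 1` vertices has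
rank `k`. -/
noncomputable def rootProb (k n : ℕ) : ℝ := growthMean n (rankEq k)

theorem rootProb_nonneg (k n : ℕ) : 0 ≤ rootProb k n := growthMean_nonneg (rankEq_nonneg k)

theorem rootProb_le_one (k n : ℕ) : rootProb k n ≤ 1 := by
  rw [rootProb, ← growthMean_const n 1]; exact growthMean_mono fun x _ => rankEq_le_one k x

theorem rootProb_self_pos (k : ℕ) : 0 < rootProb k k :=
  growthMean_pos (rankEq_nonneg k) (by simp [rankEq, rank_path])

end PlaneForest

-- Plane increasing trees as outcomes of the growth process

namespace PlaneTree

/-- Induction along children of the first root and remaining trees, parallel to `PlaneForest`; it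
avoids the nested recursion of `PlaneTree`. -/
theorem forest_induction {P : List PlaneTree → Prop} (nil : P [])
    (cons : ∀ a cs ts, P cs → P ts → P (node a cs :: ts)) : ∀ ts, P ts
  | [] => nil
  | node a cs :: ts => cons a cs ts (forest_induction nil cons cs) (forest_induction nil cons ts)
termination_by ts => sizeOf ts

/-- The forest without its labels. -/
def shape : List PlaneTree → PlaneForest
  | [] => .nil
  | node _ cs :: ts => .cons (shape cs) (shape ts)
termination_by ts => sizeOf ts

/-- The forests that arise by inserting a leaf with label `ℓ`. -/
def leafInsertions (ℓ : ℕ) : List PlaneTree → List (List PlaneTree)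
  | [] => [[node ℓ []]]
  | node a cs :: ts => (node ℓ [] :: node a cs :: ts) ::
      ((leafInsertions ℓ cs).map (fun c => node a c :: ts) ++
        (leafInsertions ℓ ts).map (fun t => node a cs :: t))
termination_by ts => sizeOf ts

/-- Deletion of the vertices labelled `ℓ`, together with their descendants. -/
def deleteLabel (ℓ : ℕ) : List PlaneTree → List PlaneTree
  | [] => []
  | node a cs :: ts => if a = ℓ then deleteLabel ℓ ts
      else node a (deleteLabel ℓ cs) :: deleteLabel ℓ ts
termination_by ts => sizeOf ts

/-- All trees of the forest are increasing with root labels larger than `b`. -/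
def IncreasingAbove (b : ℕ) (ts : List PlaneTree) : Prop :=
  ∀ t ∈ ts, b < t.root ∧ t.IsIncreasing

theorem isIncreasing_node {a : ℕ} {ts : List PlaneTree} :
    (node a ts).IsIncreasing ↔ IncreasingAbove a ts := by
  constructor
  · rintro (⟨_, _, h1, h2⟩)
    exact fun t ht => ⟨h1 t ht, h2 t ht⟩
  · exact fun h => .node a ts (fun t ht => (h t ht).1) fun t ht => (h t ht).2

theorem increasingAbove_nil (b : ℕ) : IncreasingAbove b [] := by simp [IncreasingAbove]

theorem increasingAbove_cons {b a : ℕ} {cs ts : List PlaneTree} :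
    IncreasingAbove b (node a cs :: ts) ↔
      b < a ∧ IncreasingAbove a cs ∧ IncreasingAbove b ts := by
  rw [IncreasingAbove, List.forall_mem_cons, isIncreasing_node, and_assoc]; rfl

theorem forestLabels_cons (a : ℕ) (cs ts : List PlaneTree) :
    forestLabels (node a cs :: ts) = a :: (forestLabels cs ++ forestLabels ts) := by
  simp [forestLabels, labels]

theorem forestLabels_leafInsertions {ℓ : ℕ} {ts u : List PlaneTree}
    (hu : u ∈ leafInsertions ℓ ts) : (forestLabels u).Perm (ℓ :: forestLabels ts) := by
  induction ts using forest_induction generalizing u with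
  | nil =>
    simp only [leafInsertions, List.mem_singleton] at hu
    subst hu; simp [labels, forestLabels]
  | cons a cs ts ihc iht =>
    simp only [leafInsertions, List.mem_cons, List.mem_append, List.mem_map] at hu
    rcases hu with rfl | ⟨c, hc, rfl⟩ | ⟨t, ht, rfl⟩
    · rw [forestLabels_cons]; simp [forestLabels]
    · simp only [forestLabels_cons]
      refine (((ihc hc).append_right _).cons a).trans ?_
      exact List.Perm.swap _ _ _
    · simp only [forestLabels_cons]
      refine (((iht ht).append_left _).cons a).trans ?_
      exact (List.perm_middle.cons a).trans (List.Perm.swap _ _ _)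

theorem increasingAbove_leafInsertions {ℓ b : ℕ} {ts u : List PlaneTree}
    (hu : u ∈ leafInsertions ℓ ts) (hb : b < ℓ) (hts : IncreasingAbove b ts)
    (hℓ : ∀ x ∈ forestLabels ts, x < ℓ) : IncreasingAbove b u := by
  induction ts using forest_induction generalizing u b with
  | nil =>
    simp only [leafInsertions, List.mem_singleton] at hu
    subst hu; exact increasingAbove_cons.2 ⟨hb, increasingAbove_nil _, increasingAbove_nil _⟩
  | cons a cs ts ihc iht =>
    simp only [leafInsertions, List.mem_cons, List.mem_append, List.mem_map] at hu
    obtain ⟨h1, h2, h3⟩ := increasingAbove_cons.1 hts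
    simp only [forestLabels_cons, List.mem_cons, List.mem_append] at hℓ
    rcases hu with rfl | ⟨c, hc, rfl⟩ | ⟨t, ht, rfl⟩
    · exact increasingAbove_cons.2 ⟨hb, increasingAbove_nil _, hts⟩
    · exact increasingAbove_cons.2
        ⟨h1, ihc hc (hℓ a (.inl rfl)) h2 fun x hx => hℓ x (.inr (.inl hx)), h3⟩
    · exact increasingAbove_cons.2 ⟨h1, h2, iht ht hb h3 fun x hx => hℓ x (.inr (.inr hx))⟩

theorem deleteLabel_of_not_mem {ℓ : ℕ} {ts : List PlaneTree} (h : ℓ ∉ forestLabels ts) :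
    deleteLabel ℓ ts = ts := by
  induction ts using forest_induction with
  | nil => simp [deleteLabel]
  | cons a cs ts ihc iht =>
    simp only [forestLabels_cons, List.mem_cons, List.mem_append, not_or] at h
    rw [deleteLabel, if_neg (Ne.symm h.1), ihc h.2.1, iht h.2.2]

theorem deleteLabel_leafInsertions {ℓ : ℕ} {ts u : List PlaneTree}
    (hu : u ∈ leafInsertions ℓ ts) (h : ℓ ∉ forestLabels ts) : deleteLabel ℓ u = ts := by
  induction ts using forest_induction generalizing u with
  | nil =>
    simp only [leafInsertions, List.mem_singleton] at hu
    subst hu; simp [deleteLabel]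
  | cons a cs ts ihc iht =>
    have h' := h
    simp only [leafInsertions, List.mem_cons, List.mem_append, List.mem_map] at hu
    simp only [forestLabels_cons, List.mem_cons, List.mem_append, not_or] at h
    rcases hu with rfl | ⟨c, hc, rfl⟩ | ⟨t, ht, rfl⟩
    · rw [deleteLabel, if_pos rfl, deleteLabel_of_not_mem h']
    · rw [deleteLabel, if_neg (Ne.symm h.1), ihc hc h.2.1, deleteLabel_of_not_mem h.2.2]
    · rw [deleteLabel, if_neg (Ne.symm h.1), iht ht h.2.2, deleteLabel_of_not_mem h.2.1]

theorem nodup_leafInsertions {ℓ : ℕ} {ts : List PlaneTree} (h : ℓ ∉ forestLabels ts) :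
    (leafInsertions ℓ ts).Nodup := by
  induction ts using forest_induction with
  | nil => simp [leafInsertions]
  | cons a cs ts ihc iht =>
    simp only [forestLabels_cons, List.mem_cons, List.mem_append, not_or] at h
    rw [leafInsertions, List.nodup_cons, List.nodup_append]
    refine ⟨?_, (ihc h.2.1).map fun x y hxy => by simpa using hxy,
      (iht h.2.2).map fun x y hxy => by simpa using hxy, ?_⟩
    · simp only [List.mem_append, List.mem_map, not_or, not_exists, not_and]
      exact ⟨fun c _ hc => by simp at hc,
        fun c _ hc => h.1 (by simp at hc; exact hc.1.1.symm)⟩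
    · simp only [List.mem_map]
      rintro _ ⟨c, hc, rfl⟩ _ ⟨t, ht, rfl⟩ heq
      have hcs : c = cs := by simp at heq; exact heq.1
      subst hcs
      -- An insertion adds one label, so it cannot return the forest it started from.
      have := (forestLabels_leafInsertions hc).length_eq
      simp at this

/-- In an increasing forest the largest label sits at a leaf, since a child would carry a larger
one. Deleting it therefore removes a single vertex and is undone by an insertion. -/
theorem mem_leafInsertions_deleteLabel {ℓ b : ℕ} {u : List PlaneTree}
    (hu : IncreasingAbove b u) (hnd : (forestLabels u).Nodup)
    (hle : ∀ x ∈ forestLabels u, x ≤ ℓ) (hℓ : ℓ ∈ forestLabels u) :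
    u ∈ leafInsertions ℓ (deleteLabel ℓ u) ∧ IncreasingAbove b (deleteLabel ℓ u) := by
  induction u using forest_induction generalizing b with
  | nil => simp [forestLabels] at hℓ
  | cons a cs ts ihc iht =>
    obtain ⟨h1, h2, h3⟩ := increasingAbove_cons.1 hu
    simp only [forestLabels_cons, List.mem_cons, List.mem_append, List.nodup_cons, not_or,
      List.nodup_append] at hle hℓ hnd
    obtain ⟨⟨ha1, ha2⟩, hn1, hn2, hdis⟩ := hnd
    by_cases haℓ : a = ℓ
    · subst haℓ
      have hcs : cs = [] := by
        rcases cs with _ | ⟨⟨c, ds⟩, cs⟩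
        · rfl
        · have := (increasingAbove_cons.1 h2).1
          have := hle c (.inr (.inl (by simp [forestLabels_cons])))
          omega
      subst hcs
      rw [deleteLabel, if_pos rfl, deleteLabel_of_not_mem ha2]
      refine ⟨?_, h3⟩
      rcases ts with _ | ⟨⟨c, ds⟩, ts⟩ <;> simp [leafInsertions]
    · rw [deleteLabel, if_neg haℓ]
      rcases hℓ with rfl | hℓ | hℓ
      · exact absurd rfl haℓ
      · obtain ⟨e1, e2⟩ := ihc h2 hn1 (fun x hx => hle x (.inr (.inl hx))) hℓ
        rw [deleteLabel_of_not_mem (ts := ts) fun h => hdis _ hℓ _ h rfl, increasingAbove_cons]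
        refine ⟨?_, h1, e2, h3⟩
        rw [leafInsertions]
        simp only [List.mem_cons, List.mem_append, List.mem_map]
        exact .inr (.inl ⟨cs, e1, rfl⟩)
      · obtain ⟨e1, e2⟩ := iht h3 hn2 (fun x hx => hle x (.inr (.inr hx))) hℓ
        rw [deleteLabel_of_not_mem (ts := cs) fun h => hdis _ h _ hℓ rfl, increasingAbove_cons]
        refine ⟨?_, h1, h2, e2⟩
        rw [leafInsertions]
        simp only [List.mem_cons, List.mem_append, List.mem_map]
        exact .inr (.inr ⟨ts, e1, rfl⟩)

/-- The forests on `{2, …, n + 1}` that arise by deleting the root of a plane increasing tree on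
`{1, …, n + 1}`. -/
def labelledForests : ℕ → List (List PlaneTree)
  | 0 => [[]]
  | n + 1 => (labelledForests n).flatMap (leafInsertions (n + 2))

theorem mem_labelledForests {n : ℕ} {ts : List PlaneTree} :
    ts ∈ labelledForests n ↔ IncreasingAbove 1 ts ∧ (forestLabels ts).Nodup ∧
      ∀ x, x ∈ forestLabels ts ↔ 2 ≤ x ∧ x ≤ n + 1 := by
  induction n generalizing ts with
  | zero =>
    simp only [labelledForests, List.mem_singleton]
    constructor
    · rintro rfl
      refine ⟨increasingAbove_nil 1, by simp [forestLabels], fun x => ?_⟩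
      simp only [forestLabels, List.not_mem_nil, false_iff]; omega
    · rintro ⟨-, -, h⟩
      rcases ts with _ | ⟨⟨a, cs⟩, ts⟩
      · rfl
      · have := (h a).1 (by simp [forestLabels_cons]); omega
  | succ n ih =>
    simp only [labelledForests, List.mem_flatMap]
    constructor
    · rintro ⟨us, hus, hts⟩
      obtain ⟨h1, h2, h3⟩ := ih.1 hus
      have hp := forestLabels_leafInsertions hts
      refine ⟨increasingAbove_leafInsertions hts (by omega) h1
        fun x hx => by have := (h3 x).1 hx; omega, ?_, fun x => ?_⟩
      · rw [hp.nodup_iff, List.nodup_cons]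
        exact ⟨fun h => by have := (h3 _).1 h; omega, h2⟩
      · rw [hp.mem_iff, List.mem_cons, h3]; omega
    · rintro ⟨h1, h2, h3⟩
      obtain ⟨e1, e2⟩ := mem_leafInsertions_deleteLabel (ℓ := n + 2) h1 h2
        (fun x hx => ((h3 x).1 hx).2) ((h3 _).2 (by omega))
      refine ⟨_, ih.2 ⟨e2, ?_, fun x => ?_⟩, e1⟩
      all_goals
        have hp := forestLabels_leafInsertions e1
        have hnd := h2
        rw [hp.nodup_iff, List.nodup_cons] at hnd
      · exact hnd.2
      · have h4 := h3 x
        rw [hp.mem_iff, List.mem_cons] at h4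
        constructor
        · intro hx
          have h5 := h4.1 (.inr hx)
          have : x ≠ n + 2 := fun h => hnd.1 (h ▸ hx)
          omega
        · intro hx
          exact (h4.2 (by omega)).resolve_left (by omega)

theorem nodup_labelledForests (n : ℕ) : (labelledForests n).Nodup := by
  induction n with
  | zero => simp [labelledForests]
  | succ n ih =>
    have hmem : ∀ ts ∈ labelledForests n, n + 2 ∉ forestLabels ts := fun ts hts h => by
      have := ((mem_labelledForests.1 hts).2.2 _).1 h; omega
    rw [labelledForests, List.nodup_flatMap]
    refine ⟨fun ts hts => nodup_leafInsertions (hmem ts hts), ?_⟩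
    refine List.Pairwise.imp_of_mem ?_ ih
    intro x y hx hy hxy u hux huy
    exact hxy ((deleteLabel_leafInsertions hux (hmem x hx)).symm.trans
      (deleteLabel_leafInsertions huy (hmem y hy)))

theorem labels_node (a : ℕ) (ts : List PlaneTree) : (node a ts).labels = a :: forestLabels ts := by
  simp [labels]

theorem mem_increasingTrees_succ {n : ℕ} {T : PlaneTree} :
    T ∈ increasingTrees (n + 1) ↔ ∃ ts ∈ labelledForests n, node 1 ts = T := by
  have hroot : ∀ {b : ℕ} {us : List PlaneTree}, IncreasingAbove b us →
      ∀ x ∈ forestLabels us, b < x := by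
    intro b us
    induction us using forest_induction generalizing b with
    | nil => simp [forestLabels]
    | cons a cs ts ihc iht =>
      intro h x hx
      obtain ⟨h1, h2, h3⟩ := increasingAbove_cons.1 h
      simp only [forestLabels_cons, List.mem_cons, List.mem_append] at hx
      rcases hx with rfl | hx | hx
      · exact h1
      · exact h1.trans (ihc h2 x hx)
      · exact iht h3 x hx
  rcases T with ⟨a, ts⟩
  simp only [increasingTrees, Set.Finite.mem_toFinset, increasingTreeSet, Set.mem_ofPred_eq,
    isIncreasing_node, labels_node, List.nodup_cons, Finset.ext_iff, List.mem_toFinset,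
    List.mem_cons, Finset.mem_Icc, node.injEq]
  constructor
  · rintro ⟨h1, ⟨h2, h3⟩, h4⟩
    have ha : a = 1 := by
      have e1 := (h4 a).1 (.inl rfl)
      rcases (h4 1).2 (by omega) with h | h
      · exact h.symm
      · have := hroot h1 _ h; omega
    subst ha
    refine ⟨ts, mem_labelledForests.2 ⟨h1, h3, fun x => ?_⟩, rfl, rfl⟩
    have h5 := h4 x
    constructor
    · intro hx
      have := hroot h1 _ hx
      have := h5.1 (.inr hx)
      omega
    · intro hx
      exact (h5.2 (by omega)).resolve_left (by omega)
  · rintro ⟨us, hus, rfl, rfl⟩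
    obtain ⟨h1, h2, h3⟩ := mem_labelledForests.1 hus
    refine ⟨h1, ⟨fun h => by have := (h3 1).1 h; omega, h2⟩, fun x => ?_⟩
    rw [h3]; omega

theorem sum_leafInsertions (f : PlaneForest → ℝ) (ℓ : ℕ) (ts : List PlaneTree) :
    ((leafInsertions ℓ ts).map fun u => f (shape u)).sum = PlaneForest.insSum f (shape ts) := by
  induction ts using forest_induction generalizing f with
  | nil => simp [leafInsertions, shape, PlaneForest.insSum, PlaneForest.innerSum]
  | cons a cs ts ihc iht =>
    have h1 := ihc fun x => f (.cons x (shape ts))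
    have h2 := iht fun x => f (.cons (shape cs) x)
    simp only [leafInsertions, List.map_cons, List.map_append, List.map_map, List.sum_cons,
      List.sum_append, Function.comp_def, shape]
    rw [PlaneForest.insSum, PlaneForest.innerSum_cons, h1, h2]

theorem size_shape (ts : List PlaneTree) : (shape ts).size = (forestLabels ts).length := by
  induction ts using forest_induction with
  | nil => simp [shape, PlaneForest.size, forestLabels]
  | cons a cs ts ihc iht => simp [shape, PlaneForest.size, forestLabels_cons, ihc, iht]

theorem size_shape_of_mem {n : ℕ} {ts : List PlaneTree} (h : ts ∈ labelledForests n) :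
    (shape ts).size = n := by
  induction n generalizing ts with
  | zero => simp only [labelledForests, List.mem_singleton] at h; subst h; simp [shape, PlaneForest.size]
  | succ n ih =>
    simp only [labelledForests, List.mem_flatMap] at h
    obtain ⟨us, hus, hts⟩ := h
    rw [size_shape, (forestLabels_leafInsertions hts).length_eq, List.length_cons, ← size_shape,
      ih hus]

/-- The number `∏_{i<n} (2i+1)` of plane increasing trees on `n + 1` vertices. -/
def treeNumber (n : ℕ) : ℕ := ∏ i ∈ Finset.range n, (2 * i + 1)

theorem treeNumber_pos (n : ℕ) : 0 < treeNumber n := Finset.prod_pos fun _ _ => by omega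

theorem treeNumber_succ (n : ℕ) : treeNumber (n + 1) = treeNumber n * (2 * n + 1) :=
  Finset.prod_range_succ _ _

/-- Every forest of size n has the same number 2n + 1 of insertions, so the growth process induces
the uniform distribution on labelled forests. -/
theorem sum_labelledForests (f : PlaneForest → ℝ) (n : ℕ) :
    ((labelledForests n).map fun u => f (shape u)).sum =
      treeNumber n * PlaneForest.growthMean n f := by
  induction n generalizing f with
  | zero => simp [labelledForests, treeNumber, PlaneForest.growthMean, shape]
  | succ n ih =>
    have h := ih fun x => (2 * n + 1) * PlaneForest.insMean f x
    rw [PlaneForest.growthMean_mul_left] at h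
    rw [labelledForests, List.map_flatMap, List.flatMap_def, List.sum_flatten, List.map_map,
      treeNumber_succ,
      PlaneForest.growthMean]
    push_cast
    rw [mul_assoc, ← h]
    congr 1
    refine List.map_congr_left fun ts hts => ?_
    rw [Function.comp_apply, sum_leafInsertions, PlaneForest.insSum_eq, size_shape_of_mem hts]

/-- The forest below the root. -/
def children : PlaneTree → List PlaneTree
  | node _ ts => ts

theorem sum_increasingTrees (f : PlaneForest → ℝ) (n : ℕ) :
    ∑ T ∈ increasingTrees (n + 1), f (shape T.children) =
      treeNumber n * PlaneForest.growthMean n f := by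
  classical
  have h : increasingTrees (n + 1) = ((labelledForests n).map (node 1)).toFinset := by
    ext T; simp [mem_increasingTrees_succ]
  have hnd : ((labelledForests n).map (node 1)).Nodup :=
    (nodup_labelledForests n).map fun x y hxy => by simpa using hxy
  rw [h, List.sum_toFinset _ hnd, List.map_map, ← sum_labelledForests]
  rfl

theorem card_increasingTrees (n : ℕ) : (increasingTrees (n + 1)).card = treeNumber n := by
  have h := sum_increasingTrees (fun _ => 1) n
  rw [PlaneForest.growthMean_const] at h
  simp only [Finset.sum_const, nsmul_eq_mul, mul_one] at h
  exact_mod_cast h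

/-! ### Ranks -/

theorem rootRank_node (a : ℕ) (ts : List PlaneTree) :
    (node a ts).rootRank = (shape ts).rank := by
  -- The forest hangs below an auxiliary root with arbitrary label, so that the induction hypotheses
  -- cover both the children of the first root and its remaining siblings.
  have key : ∀ us : List PlaneTree, ∀ a, (node a us).HasLeafAtDepth (shape us).rank ∧
      ∀ d, (node a us).HasLeafAtDepth d → (shape us).rank ≤ d := by
    intro us
    induction us using forest_induction with
    | nil =>
      intro a
      simp only [shape, PlaneForest.rank]
      exact ⟨.leaf a, fun d _ => Nat.zero_le d⟩
    | cons b cs us ihc iht =>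
      intro a
      -- For `us = []` this fails: the auxiliary root would itself be a leaf, at depth 0.
      have hup : ∀ d, (node a us).HasLeafAtDepth d → us ≠ [] →
          (node a (node b cs :: us)).HasLeafAtDepth d := by
        rintro d (_ | ⟨_, _, t, d, ht, hd⟩) hne
        · exact absurd rfl hne
        · exact .child _ _ t d (List.mem_cons_of_mem _ ht) hd
      have hfst : (node a (node b cs :: us)).HasLeafAtDepth ((shape cs).rank + 1) :=
        .child _ _ _ _ List.mem_cons_self (ihc b).1
      by_cases hus : us = []
      · subst hus
        simp only [shape, PlaneForest.rank_cons_nil]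
        refine ⟨hfst, ?_⟩
        rintro _ (_ | ⟨_, _, t, d, ht, hd⟩)
        simp only [List.mem_singleton] at ht
        subst ht
        have := (ihc b).2 d hd
        omega
      · have hne : shape us ≠ .nil := by
          rcases us with _ | ⟨⟨c, ds⟩, us⟩
          · exact absurd rfl hus
          · simp [shape]
        simp only [shape, PlaneForest.rank_cons_of_ne _ hne]
        constructor
        · rcases min_choice ((shape cs).rank + 1) (shape us).rank with h | h <;> rw [h]
          · exact hfst
          · exact hup _ (iht a).1 hus
        · rintro _ (_ | ⟨_, _, t, d, ht, hd⟩)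
          rcases List.mem_cons.1 ht with rfl | ht
          · have := (ihc b).2 d hd
            omega
          · have := (iht a).2 (d + 1) (.child _ _ t d ht hd)
            omega
  exact IsLeast.csInf_eq ⟨(key ts a).1, fun d hd => (key ts a).2 d hd⟩

theorem rootRankCount_succ (k n : ℕ) :
    (rootRankCount k (n + 1) : ℝ) = treeNumber n * PlaneForest.rootProb k n := by
  classical
  rw [PlaneForest.rootProb, ← sum_increasingTrees]
  have h : rootRankCount k (n + 1) =
      ((increasingTrees (n + 1)).filter fun T => T.rootRank = k).card := by
    exact Nat.subtype_card _ fun T => Finset.mem_filter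
  rw [h, Finset.card_filter]
  push_cast
  refine Finset.sum_congr rfl ?_
  rintro ⟨a, ts⟩ _
  rw [rootRank_node]; rfl

/-- The labels of the vertices of rank `k` in a forest. -/
def rankSet (k : ℕ) (ts : List PlaneTree) : Set ℕ := {x | ∃ t ∈ ts, t.HasRank x k}

theorem hasRank_node {a x k : ℕ} {ts : List PlaneTree} :
    (node a ts).HasRank x k ↔ (x = a ∧ (shape ts).rank = k) ∨ x ∈ rankSet k ts := by
  constructor
  · rintro ⟨s, hs, rfl, rfl⟩
    rcases hs with _ | ⟨_, _, t, _, ht, hs⟩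
    · exact .inl ⟨rfl, (rootRank_node a ts).symm⟩
    · exact .inr ⟨t, ht, s, hs, rfl, rfl⟩
  · rintro (⟨rfl, h⟩ | ⟨t, ht, s, hs, h1, h2⟩)
    · exact ⟨_, .self _, rfl, (rootRank_node _ ts).trans h⟩
    · exact ⟨s, .child _ _ t s ht hs, h1, h2⟩

theorem rankSet_cons (k a : ℕ) (cs ts : List PlaneTree) :
    rankSet k (node a cs :: ts) =
      {x | x = a ∧ (shape cs).rank = k} ∪ (rankSet k cs ∪ rankSet k ts) := by
  ext x
  simp only [rankSet, List.mem_cons, exists_eq_or_imp, Set.mem_ofPred_eq, Set.mem_union,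
    hasRank_node, or_assoc]

theorem rankSet_subset (k : ℕ) (ts : List PlaneTree) :
    rankSet k ts ⊆ {x | x ∈ forestLabels ts} := by
  induction ts using forest_induction with
  | nil => simp [rankSet]
  | cons a cs ts ihc iht =>
    rw [rankSet_cons]
    rintro x (⟨rfl, _⟩ | h | h) <;>
      simp only [Set.mem_ofPred_eq, forestLabels_cons, List.mem_cons, List.mem_append]
    · exact .inl trivial
    · exact .inr (.inl (ihc h))
    · exact .inr (.inr (iht h))

theorem finite_rankSet (k : ℕ) (ts : List PlaneTree) : (rankSet k ts).Finite :=
  (List.finite_toSet (forestLabels ts)).subset (rankSet_subset k ts)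

theorem ncard_rankSet (k : ℕ) {ts : List PlaneTree} (h : (forestLabels ts).Nodup) :
    ((rankSet k ts).ncard : ℝ) = PlaneForest.additive (PlaneForest.rankEq k) (shape ts) := by
  induction ts using forest_induction with
  | nil => simp [rankSet, shape, PlaneForest.additive]
  | cons a cs ts ihc iht =>
    simp only [forestLabels_cons, List.nodup_cons, List.mem_append, not_or,
      List.nodup_append] at h
    obtain ⟨⟨h1, h2⟩, h3, h4, h5⟩ := h
    have hf : {x | x = a ∧ (shape cs).rank = k}.Finite :=
      (Set.finite_singleton a).subset fun x hx => hx.1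
    rw [rankSet_cons, Set.ncard_union_eq _ hf ((finite_rankSet _ _).union (finite_rankSet _ _)),
      Set.ncard_union_eq _ (finite_rankSet _ _) (finite_rankSet _ _)]
    · push_cast
      rw [ihc h3, iht h4, shape, PlaneForest.additive, ← add_assoc]
      congr 2
      rw [PlaneForest.rankEq]
      split_ifs with hk <;> simp [hk]
    · exact Set.disjoint_left.2 fun x hx hx' =>
        h5 x (rankSet_subset _ _ hx) x (rankSet_subset _ _ hx') rfl
    · refine Set.disjoint_left.2 ?_
      rintro x ⟨rfl, _⟩ (hx | hx)
      · exact h1 (rankSet_subset _ _ hx)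
      · exact h2 (rankSet_subset _ _ hx)

-- The constant `rankConst` as a series

open PlaneForest

theorem hasDerivAt_mul_sqrt {x : ℝ} (hx : x < 1 / 2) :
    HasDerivAt (fun y : ℝ => (1 - 2 * y) * √(1 - 2 * y)) (-3 * √(1 - 2 * x)) x := by
  have hpos : 0 < 1 - 2 * x := by linarith
  have h1 : HasDerivAt (fun y : ℝ => 1 - 2 * y) (-2) x := by
    simpa using ((hasDerivAt_id x).const_mul 2).const_sub 1
  refine (h1.mul (h1.sqrt hpos.ne')).congr_deriv ?_
  have h2 : √(1 - 2 * x) ≠ 0 := (Real.sqrt_pos.2 hpos).ne'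
  have h3 := Real.mul_self_sqrt hpos.le
  field_simp
  nlinarith

/-- A Beta integral. Integrating the derivative of (1 - 2x)^(3/2) x^(n+1), which vanishes at both
ends, gives the recurrence I_{n+1} = (n + 1) / (2n + 5) · I_n. -/
theorem integral_sqrt_mul_pow (n : ℕ) :
    ∫ x in (0 : ℝ)..(1 / 2), √(1 - 2 * x) * x ^ n =
      n.factorial / (treeNumber n * ((2 * n + 1) * (2 * n + 3))) := by
  have hcont : ∀ m : ℕ, Continuous fun x : ℝ => √(1 - 2 * x) * x ^ m := fun m => by fun_prop
  induction n with
  | zero =>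
    have h := intervalIntegral.integral_eq_sub_of_hasDerivAt_of_le (a := 0) (b := 1 / 2)
      (f := fun x : ℝ => (-1 / 3) * ((1 - 2 * x) * √(1 - 2 * x)))
      (f' := fun x : ℝ => √(1 - 2 * x) * x ^ 0) (by norm_num) (by fun_prop)
      (fun x hx => ((hasDerivAt_mul_sqrt hx.2).const_mul (-1 / 3)).congr_deriv (by ring))
      ((hcont 0).intervalIntegrable _ _)
    rw [h]
    norm_num [treeNumber]
  | succ n ih =>
    have h := intervalIntegral.integral_eq_sub_of_hasDerivAt_of_le (a := 0) (b := 1 / 2)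
      (f := fun x : ℝ => ((1 - 2 * x) * √(1 - 2 * x)) * x ^ (n + 1))
      (f' := fun x : ℝ => (n + 1) * (√(1 - 2 * x) * x ^ n) -
        (2 * n + 5) * (√(1 - 2 * x) * x ^ (n + 1))) (by norm_num) (by fun_prop)
      (fun x hx => ((hasDerivAt_mul_sqrt hx.2).mul (hasDerivAt_pow (n + 1) x)).congr_deriv (by
        simp only [Nat.add_sub_cancel]
        push_cast
        ring))
      (Continuous.intervalIntegrable (by fun_prop) _ _)
    rw [intervalIntegral.integral_sub (((hcont n).const_mul _).intervalIntegrable _ _)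
      (((hcont (n + 1)).const_mul _).intervalIntegrable _ _),
      intervalIntegral.integral_const_mul, intervalIntegral.integral_const_mul, ih] at h
    rw [show (1 : ℝ) - 2 * (1 / 2) = 0 by norm_num, zero_mul, zero_mul,
      zero_pow (Nat.succ_ne_zero n), mul_zero, sub_zero] at h
    have hw : (treeNumber n : ℝ) ≠ 0 := by exact_mod_cast (treeNumber_pos n).ne'
    rw [treeNumber_succ, Nat.factorial_succ]
    push_cast
    have h5 : (2 * n + 5 : ℝ) ≠ 0 := by positivity
    rw [← mul_right_inj' h5, ← sub_eq_zero.1 h]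
    field_simp
    ring

theorem treeNumber_le (n : ℕ) : (treeNumber n : ℝ) ≤ 2 ^ n * n.factorial := by
  induction n with
  | zero => simp [treeNumber]
  | succ n ih =>
    rw [treeNumber_succ, Nat.factorial_succ]
    push_cast
    calc (treeNumber n : ℝ) * (2 * n + 1) ≤ (2 ^ n * n.factorial) * (2 * (n + 1)) := by
          gcongr; linarith
      _ = _ := by ring

/-- The coefficients of the derivative of the generating function `B_k`. -/
noncomputable def derivCoeff (k n : ℕ) : ℝ := treeNumber n * rootProb k n / n.factorial

theorem derivCoeff_nonneg (k n : ℕ) : 0 ≤ derivCoeff k n :=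
  div_nonneg (mul_nonneg (Nat.cast_nonneg _) (rootProb_nonneg k n)) (Nat.cast_nonneg _)

theorem derivCoeff_le (k n : ℕ) : derivCoeff k n ≤ 2 ^ n := by
  rw [derivCoeff, div_le_iff₀ (by positivity)]
  exact (mul_le_of_le_one_right (Nat.cast_nonneg _) (rootProb_le_one k n)).trans (treeNumber_le n)

theorem deriv_rootRankEGF (k : ℕ) {x : ℝ} (h0 : 0 ≤ x) (hx : x < 1 / 2) :
    deriv (rootRankEGF k) x = ∑' n, derivCoeff k n * x ^ n := by
  obtain ⟨ρ, hρ1, hρ2⟩ := exists_between hx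
  have hρ0 : 0 < ρ := h0.trans_lt hρ1
  set g' : ℕ → ℝ → ℝ := fun n y =>
    (rootRankCount k n : ℝ) * (n * y ^ (n - 1)) / (n.factorial : ℝ) with hg'
  have hsucc : ∀ n y, g' (n + 1) y = derivCoeff k n * y ^ n := by
    intro n y
    simp only [hg', rootRankCount_succ, derivCoeff, Nat.factorial_succ, Nat.add_sub_cancel]
    push_cast
    field_simp
  -- The constant term has derivative 0, so the geometric majorant starts at index 1; its ratio is
  -- 2ρ < 1.
  set u : ℕ → ℝ := fun n => n.casesOn 0 fun m => (2 * ρ) ^ m with hu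
  have husum : Summable u := by
    rw [← summable_nat_add_iff 1]
    exact summable_geometric_of_lt_one (by positivity) (by linarith)
  have hbound : ∀ n y, y ∈ Set.Ioo (-ρ) ρ → ‖g' n y‖ ≤ u n := by
    intro n y hy
    cases n with
    | zero => simp [hg', hu]
    | succ n =>
      rw [hsucc, Real.norm_eq_abs, abs_mul, abs_pow, abs_of_nonneg (derivCoeff_nonneg k n)]
      simp only [hu, mul_pow]
      exact mul_le_mul (derivCoeff_le k n)
        (pow_le_pow_left₀ (abs_nonneg y) (abs_le.2 ⟨hy.1.le, hy.2.le⟩) n) (by positivity)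
        (by positivity)
  have hd : HasDerivAt (rootRankEGF k) (∑' n, g' n x) x :=
    hasDerivAt_tsum_of_isPreconnected (t := Set.Ioo (-ρ) ρ) (y₀ := 0)
      (g := fun n y => (rootRankCount k n : ℝ) * y ^ n / (n.factorial : ℝ)) husum isOpen_Ioo
      isPreconnected_Ioo
      (fun n y _ => ((hasDerivAt_pow n y).const_mul _).div_const _) hbound
      ⟨by linarith, hρ0⟩
      (summable_of_ne_finset_zero (s := {0}) fun n hn => by
        have : n ≠ 0 := by simpa using hn
        simp [this])
      ⟨by linarith, hρ1⟩
  have hsum : Summable fun n => g' n x :=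
    Summable.of_norm_bounded husum fun n => hbound n x ⟨by linarith, hρ1⟩
  rw [hd.deriv, hsum.tsum_eq_zero_add]
  simp only [hsucc]
  simp [hg']

/-- The constant `c_k` as a series. -/
theorem hasSum_rankConst (k : ℕ) :
    HasSum (fun m : ℕ => 2 * (rootProb k m / ((2 * m + 1) * (2 * m + 3)))) (rankConst k) := by
  refine HasSum.mul_left 2 ?_
  set F : ℕ → ℝ → ℝ := fun n x => √(1 - 2 * x) * (derivCoeff k n * x ^ n) with hF
  have hint : ∀ n, MeasureTheory.IntegrableOn (F n) (Set.Ioo 0 (1 / 2)) := by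
    intro n
    have : Continuous (F n) := by simp only [hF]; fun_prop
    exact (this.integrableOn_Icc).mono_set Set.Ioo_subset_Icc_self
  have hval : ∀ n : ℕ, ∫ x in Set.Ioo (0 : ℝ) (1 / 2), F n x =
      rootProb k n / ((2 * n + 1) * (2 * n + 3)) := by
    intro n
    rw [← MeasureTheory.integral_Ioc_eq_integral_Ioo,
      ← intervalIntegral.integral_of_le (by norm_num)]
    have : ∀ x, F n x = derivCoeff k n * (√(1 - 2 * x) * x ^ n) := fun x => by
      simp only [hF]; ring
    simp only [this]
    rw [intervalIntegral.integral_const_mul, integral_sqrt_mul_pow, derivCoeff]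
    have hw : (treeNumber n : ℝ) ≠ 0 := by exact_mod_cast (treeNumber_pos n).ne'
    field_simp
  -- All terms are nonnegative on the interval, so summability of their integrals already justifies
  -- integrating termwise.
  have hnorm : ∀ n : ℕ, ∫ x in Set.Ioo (0 : ℝ) (1 / 2), ‖F n x‖ =
      rootProb k n / ((2 * n + 1) * (2 * n + 3)) := by
    intro n
    rw [← hval]
    refine MeasureTheory.setIntegral_congr_fun measurableSet_Ioo fun x hx => ?_
    exact Real.norm_of_nonneg (mul_nonneg (Real.sqrt_nonneg _)
      (mul_nonneg (derivCoeff_nonneg k n) (pow_nonneg hx.1.le n)))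
  have hsum : Summable fun n : ℕ => rootProb k n / ((2 * n + 1) * (2 * n + 3) : ℝ) := by
    refine Summable.of_nonneg_of_le (fun n => div_nonneg (rootProb_nonneg k n) (by positivity))
      (fun n => ?_) ((summable_nat_add_iff 1).2 (Real.summable_one_div_nat_pow.2 one_lt_two))
    refine div_le_div₀ zero_le_one (rootProb_le_one k n) (by positivity) ?_
    push_cast
    nlinarith [(Nat.cast_nonneg n : (0 : ℝ) ≤ n)]
  have h := MeasureTheory.hasSum_integral_of_summable_integral_norm hint (by simpa only [hnorm])
  simp only [hval] at h
  rw [intervalIntegral.integral_of_le (by norm_num), MeasureTheory.integral_Ioc_eq_integral_Ioo]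
  have heq : ∫ x in Set.Ioo (0 : ℝ) (1 / 2), √(1 - 2 * x) * deriv (rootRankEGF k) x =
      ∫ x in Set.Ioo (0 : ℝ) (1 / 2), ∑' n, F n x := by
    refine MeasureTheory.setIntegral_congr_fun measurableSet_Ioo fun x hx => ?_
    simp only [hF]
    rw [tsum_mul_left, deriv_rootRankEGF k hx.1.le hx.2]
  rw [heq]
  exact h

theorem rankConst_pos (k : ℕ) : 0 < rankConst k :=
  (mul_pos two_pos (div_pos (rootProb_self_pos k) (by positivity))).trans_le
    (le_hasSum (hasSum_rankConst k) k fun m _ =>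
      mul_nonneg zero_le_two (div_nonneg (rootProb_nonneg k m) (by positivity)))

theorem sum_rootProb_le (k n : ℕ) :
    2 * ∑ m ∈ Finset.range n, rootProb k m / ((2 * m + 1) * (2 * m + 3) : ℝ) ≤ rankConst k := by
  rw [Finset.mul_sum]
  exact sum_le_hasSum _ (fun m _ => mul_nonneg zero_le_two
    (div_nonneg (rootProb_nonneg k m) (by positivity))) (hasSum_rankConst k)

/-- As p_m ≤ 1 and 2 / ((2m + 1)(2m + 3)) = 1 / (2m + 1) - 1 / (2m + 3), the tail telescopes. -/
theorem rankConst_le_sum (k n : ℕ) :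
    rankConst k ≤ 2 * ∑ m ∈ Finset.range n, rootProb k m / ((2 * m + 1) * (2 * m + 3) : ℝ) +
      1 / (2 * n + 1) := by
  have key : ∀ j : ℕ, 2 * ∑ m ∈ Finset.range (n + j),
        rootProb k m / ((2 * m + 1) * (2 * m + 3) : ℝ) ≤
      2 * ∑ m ∈ Finset.range n, rootProb k m / ((2 * m + 1) * (2 * m + 3) : ℝ) +
        1 / (2 * n + 1) - 1 / (2 * (n + j : ℕ) + 1) := by
    intro j
    induction j with
    | zero => simp
    | succ j ih =>
      rw [← add_assoc, Finset.sum_range_succ]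
      set N := n + j
      have h1 : rootProb k N / ((2 * N + 1) * (2 * N + 3) : ℝ) ≤
          1 / ((2 * N + 1) * (2 * N + 3) : ℝ) :=
        div_le_div_of_nonneg_right (rootProb_le_one k N) (by positivity)
      have h2 : 2 * (1 / ((2 * N + 1) * (2 * N + 3) : ℝ)) =
          1 / (2 * N + 1) - 1 / (2 * (N + 1 : ℕ) + 1) := by
        push_cast
        field_simp
        ring
      linarith
  have ht := ((hasSum_rankConst k).tendsto_sum_nat).comp (Filter.tendsto_add_atTop_nat n)
  refine le_of_tendsto' ht fun j => ?_
  simp only [Function.comp_apply, ← Finset.mul_sum]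
  rw [add_comm j n]
  have h3 : (0 : ℝ) ≤ 1 / (2 * (n + j : ℕ) + 1) := by positivity
  linarith [key j]

theorem rankConst_le_one (k : ℕ) : rankConst k ≤ 1 := by
  simpa using rankConst_le_sum k 0

-- Mean and second moment of the number of vertices of rank `k`

/-- The mean is (n + 1/2) · 2S, where the partial sum 2S falls short of c_k by at most 1 / (2n + 1).
This costs at most 1/2, and replacing n + 1/2 by n + 1 costs c_k / 2 ≤ 1/2. -/
theorem abs_growthMean_additive_sub_le (k n : ℕ) :
    |growthMean n (additive (rankEq k)) - rankConst k * (n + 1)| ≤ 1 := by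
  have h1 := sum_rootProb_le k n
  have h2 := rankConst_le_sum k n
  have h3 := rankConst_pos k
  have h4 := rankConst_le_one k
  have hpos : (0 : ℝ) < 2 * n + 1 := by positivity
  rw [growthMean_additive]
  simp only [rootProb] at h1 h2
  set S := ∑ m ∈ Finset.range n, growthMean m (rankEq k) / ((2 * m + 1) * (2 * m + 3) : ℝ)
  have h5 : (2 * n + 1) * rankConst k ≤ (2 * n + 1) * (2 * S) + 1 := by
    have := mul_le_mul_of_nonneg_left h2 hpos.le
    rw [mul_add, mul_one_div_cancel hpos.ne'] at this
    exact this
  have h6 := mul_le_mul_of_nonneg_left h1 hpos.le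
  rw [abs_le]
  constructor <;> nlinarith

/-- The number of vertices of rank `k` in the tree that arises from a forest by adding a root. -/
noncomputable def rankNumber (k : ℕ) (F : PlaneForest) : ℝ :=
  additive (rankEq k) F + rankEq k F

theorem rankNumber_nonneg (k : ℕ) (F : PlaneForest) : 0 ≤ rankNumber k F :=
  add_nonneg (additive_nonneg (rankEq_nonneg k) F) (rankEq_nonneg k F)

theorem rankNumber_le (k : ℕ) (F : PlaneForest) : rankNumber k F ≤ F.size + 1 :=
  add_le_add (additive_le_size (rankEq_le_one k) F) (rankEq_le_one k F)

/-- The deviation of the number of vertices of rank `k` from its asymptotic mean. -/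
noncomputable def rankDeviation (k : ℕ) (F : PlaneForest) : ℝ :=
  rankNumber k F - rankConst k * (F.size + 1)

theorem abs_growthMean_rankDeviation_le (k n : ℕ) :
    |growthMean n (rankDeviation k)| ≤ 2 := by
  have h : growthMean n (rankDeviation k) =
      growthMean n (additive (rankEq k)) + growthMean n (rankEq k) +
        -(rankConst k * (n + 1)) := by
    rw [← growthMean_add, ← growthMean_const n (-(rankConst k * (n + 1))), ← growthMean_add]
    refine growthMean_congr fun x hx => ?_
    rw [rankDeviation, rankNumber, hx]; ring
  have h1 := abs_le.1 (abs_growthMean_additive_sub_le k n)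
  have h2 : 0 ≤ growthMean n (rankEq k) := rootProb_nonneg k n
  have h3 : growthMean n (rankEq k) ≤ 1 := rootProb_le_one k n
  rw [h, abs_le]
  constructor <;> linarith

theorem growthMean_rankDeviation_sq_le (k n : ℕ) :
    growthMean n (fun x => rankDeviation k x ^ 2) ≤ (2 * (2 * k + 1) ^ 2 + 8) * (n + 1) := by
  set A := additive (rankEq k) with hA
  set μ := growthMean n A with hμ
  have h1 := abs_le.1 (abs_growthMean_additive_sub_le k n)
  have h2 := (swapBounded_additive_rankEq k).growthMean_sq_le n
  rw [← hA, ← hμ] at h1 h2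
  -- The deviation is (A - μ) + e with |e| ≤ 2, and (u + v)² ≤ 2u² + 2v²; the right side is 2(A -
  -- μ)² + 8 expanded.
  have h3 : growthMean n (fun x => rankDeviation k x ^ 2) ≤
      growthMean n (fun x => (2 * A x ^ 2 + (-4 * μ) * A x) + (2 * μ ^ 2 + 8)) := by
    refine growthMean_mono fun x hx => ?_
    rw [rankDeviation, rankNumber, hx, ← hA]
    have e1 := rankEq_nonneg k x
    have e2 := rankEq_le_one k x
    have e3 : (μ - rankConst k * (n + 1) + rankEq k x) ^ 2 ≤ 2 ^ 2 :=
      sq_le_sq' (by linarith) (by linarith)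
    nlinarith [sq_nonneg ((A x - μ) - (μ - rankConst k * (n + 1) + rankEq k x))]
  rw [growthMean_add, growthMean_add, growthMean_mul_left, growthMean_mul_left,
    growthMean_const, ← hμ] at h3
  nlinarith [sq_nonneg (2 * (k : ℝ) + 1)]

-- Mixed moments of the rank counts

section Moments

variable {ι : Type*} (k : ι → ℕ)

theorem prod_rankNumber_nonneg (s : Finset ι) (F : PlaneForest) :
    0 ≤ ∏ j ∈ s, rankNumber (k j) F :=
  Finset.prod_nonneg fun j _ => rankNumber_nonneg (k j) F

theorem prod_rankNumber_le (s : Finset ι) (F : PlaneForest) :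
    ∏ j ∈ s, rankNumber (k j) F ≤ ((F.size : ℝ) + 1) ^ s.card := by
  rw [← Finset.prod_const]
  exact Finset.prod_le_prod (fun j _ => rankNumber_nonneg (k j) F)
    fun j _ => rankNumber_le (k j) F

/-- Bounding the deviation by its second moment alone would lose a factor √n. Instead one factor is
split into its main term, where the induction hypothesis applies, and a second deviation; the
product of two deviations has mean O(n) by the inequality |uv| ≤ (u² + v²) / 2. -/
theorem exists_abs_growthMean_rankDeviation_mul_le (i : ι) (s : Finset ι) :
    ∃ C : ℝ, ∀ n : ℕ, |growthMean n fun x => rankDeviation (k i) x * ∏ j ∈ s, rankNumber (k j) x|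
      ≤ C * (n + 1 : ℝ) ^ s.card := by
  classical
  induction s using Finset.induction_on with
  | empty => exact ⟨2, fun n => by simpa using abs_growthMean_rankDeviation_le (k i) n⟩
  | insert j s hj ih =>
    obtain ⟨C, hC⟩ := ih
    set K : ι → ℝ := fun i => 2 * (2 * k i + 1) ^ 2 + 8 with hK
    refine ⟨C + (K i + K j) / 2, fun n => ?_⟩
    have h1 : growthMean n (fun x => rankDeviation (k i) x *
          ∏ l ∈ insert j s, rankNumber (k l) x) =
        (rankConst (k j) * (n + 1)) *
          growthMean n (fun x => rankDeviation (k i) x * ∏ l ∈ s, rankNumber (k l) x) +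
        growthMean n (fun x => rankDeviation (k i) x * rankDeviation (k j) x *
          ∏ l ∈ s, rankNumber (k l) x) := by
      rw [← growthMean_mul_left, ← growthMean_add]
      refine growthMean_congr fun x hx => ?_
      rw [Finset.prod_insert hj, rankDeviation, rankDeviation, hx]; ring
    have h2 : |growthMean n (fun x => rankDeviation (k i) x * rankDeviation (k j) x *
          ∏ l ∈ s, rankNumber (k l) x)| ≤ (K i + K j) / 2 * (n + 1 : ℝ) ^ (s.card + 1) := by
      have h3 : growthMean n (fun x => |rankDeviation (k i) x * rankDeviation (k j) x *
            ∏ l ∈ s, rankNumber (k l) x|) ≤ growthMean n (fun x =>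
              ((n + 1 : ℝ) ^ s.card / 2) *
                (rankDeviation (k i) x ^ 2 + rankDeviation (k j) x ^ 2)) := by
        refine growthMean_mono fun x hx => ?_
        have e1 := prod_rankNumber_nonneg k s x
        have e2 := prod_rankNumber_le k s x
        rw [hx] at e2
        have e3 : |rankDeviation (k i) x * rankDeviation (k j) x| ≤
            (rankDeviation (k i) x ^ 2 + rankDeviation (k j) x ^ 2) / 2 := by
          rw [abs_le]
          constructor <;> nlinarith [sq_nonneg (rankDeviation (k i) x + rankDeviation (k j) x),
            sq_nonneg (rankDeviation (k i) x - rankDeviation (k j) x)]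
        rw [abs_mul, abs_of_nonneg e1]
        calc _ ≤ (rankDeviation (k i) x ^ 2 + rankDeviation (k j) x ^ 2) / 2 *
              (n + 1 : ℝ) ^ s.card := mul_le_mul e3 e2 e1 (by positivity)
          _ = _ := by ring
      refine (abs_growthMean_le n _).trans (h3.trans ?_)
      rw [growthMean_mul_left, growthMean_add]
      have e1 := growthMean_rankDeviation_sq_le (k i) n
      have e2 := growthMean_rankDeviation_sq_le (k j) n
      calc _ ≤ ((n + 1 : ℝ) ^ s.card / 2) * (K i * (n + 1) + K j * (n + 1)) :=
            mul_le_mul_of_nonneg_left (add_le_add e1 e2) (by positivity)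
        _ = _ := by ring
    rw [h1, Finset.card_insert_of_notMem hj]
    refine (abs_add_le _ _).trans ?_
    rw [add_mul]
    refine add_le_add ?_ h2
    have hc0 := (rankConst_pos (k j)).le
    have hN : (0 : ℝ) ≤ n + 1 := by positivity
    rw [abs_mul, abs_of_nonneg (mul_nonneg hc0 hN)]
    have h4 : rankConst (k j) * ((n : ℝ) + 1) ≤ n + 1 :=
      mul_le_of_le_one_left hN (rankConst_le_one (k j))
    calc _ ≤ ((n : ℝ) + 1) * (C * (n + 1 : ℝ) ^ s.card) :=
          mul_le_mul h4 (hC n) (abs_nonneg _) hN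
      _ = _ := by ring

/-- The factor n + 1 on the left expresses an error of order n^(|s| - 1) without a negative
exponent, also for empty `s`. -/
theorem exists_abs_growthMean_prod_sub_le (s : Finset ι) :
    ∃ C : ℝ, ∀ n : ℕ, |growthMean n (fun x => ∏ j ∈ s, rankNumber (k j) x) -
      (n + 1 : ℝ) ^ s.card * ∏ j ∈ s, rankConst (k j)| * (n + 1) ≤ C * (n + 1 : ℝ) ^ s.card := by
  classical
  induction s using Finset.induction_on with
  | empty => exact ⟨0, fun n => by simp [growthMean_const]⟩
  | insert i s hi ih =>
    obtain ⟨C, hC⟩ := ih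
    obtain ⟨C', hC'⟩ := exists_abs_growthMean_rankDeviation_mul_le k i s
    refine ⟨C + C', fun n => ?_⟩
    have h1 : growthMean n (fun x => ∏ j ∈ insert i s, rankNumber (k j) x) =
        (rankConst (k i) * (n + 1)) * growthMean n (fun x => ∏ j ∈ s, rankNumber (k j) x) +
          growthMean n (fun x => rankDeviation (k i) x * ∏ j ∈ s, rankNumber (k j) x) := by
      rw [← growthMean_mul_left, ← growthMean_add]
      refine growthMean_congr fun x hx => ?_
      rw [Finset.prod_insert hi, rankDeviation, hx]; ring
    have hN : (0 : ℝ) ≤ n + 1 := by positivity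
    have hc0 := (rankConst_pos (k i)).le
    have h2 : growthMean n (fun x => ∏ j ∈ insert i s, rankNumber (k j) x) -
        (n + 1 : ℝ) ^ (insert i s).card * ∏ j ∈ insert i s, rankConst (k j) =
        (rankConst (k i) * (n + 1)) * (growthMean n (fun x => ∏ j ∈ s, rankNumber (k j) x) -
          (n + 1 : ℝ) ^ s.card * ∏ j ∈ s, rankConst (k j)) +
          growthMean n (fun x => rankDeviation (k i) x * ∏ j ∈ s, rankNumber (k j) x) := by
      rw [h1, Finset.prod_insert hi, Finset.card_insert_of_notMem hi]; ring
    rw [h2, Finset.card_insert_of_notMem hi]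
    set a := growthMean n (fun x => ∏ j ∈ s, rankNumber (k j) x) -
          (n + 1 : ℝ) ^ s.card * ∏ j ∈ s, rankConst (k j)
    set b := growthMean n (fun x => rankDeviation (k i) x * ∏ j ∈ s, rankNumber (k j) x)
    have h4 : rankConst (k i) * ((n : ℝ) + 1) ≤ n + 1 :=
      mul_le_of_le_one_left hN (rankConst_le_one (k i))
    calc _ ≤ (|rankConst (k i) * (n + 1) * a| + |b|) * (n + 1) :=
          mul_le_mul_of_nonneg_right (abs_add_le _ _) hN
      _ = (rankConst (k i) * (n + 1)) * (|a| * (n + 1)) + |b| * (n + 1) := by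
          rw [abs_mul, abs_of_nonneg (mul_nonneg hc0 hN)]; ring
      _ ≤ (n + 1) * (C * (n + 1 : ℝ) ^ s.card) + (C' * (n + 1 : ℝ) ^ s.card) * (n + 1) :=
          add_le_add (mul_le_mul h4 (hC n) (mul_nonneg (abs_nonneg _) hN) hN)
            (mul_le_mul_of_nonneg_right (hC' n) hN)
      _ = _ := by ring

end Moments

/-! ### Tuples of distinct vertices -/

/-- The entry at `j` repeats the one at `i`, so it can be overwritten by an arbitrary element
without loss of information. -/
theorem card_filter_eq_mul_card_le {α : Type*} [Fintype α] [DecidableEq α] {r : ℕ} {i j : Fin r}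
    (hij : i ≠ j) : (Finset.univ.filter fun f : Fin r → α => f i = f j).card * Fintype.card α ≤
      Fintype.card α ^ r := by
  have h : Fintype.card (Fin r → α) = Fintype.card α ^ r := by simp
  rw [← h, ← Finset.card_univ (α := α), ← Finset.card_product, ← Finset.card_univ]
  refine Finset.card_le_card_of_injOn (fun p => Function.update p.1 j p.2)
    (fun _ _ => Finset.mem_coe.2 (Finset.mem_univ _)) ?_
  rintro ⟨f, a⟩ hf ⟨g, b⟩ hg heq
  simp only [Finset.coe_product, Set.mem_prod, Finset.mem_coe, Finset.mem_filter,
    Finset.mem_univ, true_and, and_true] at hf hg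
  have hval := fun l => congrFun heq l
  have hab : a = b := by simpa using hval j
  have hfg : ∀ l, l ≠ j → f l = g l := fun l hl => by simpa [hl] using hval l
  refine Prod.ext (funext fun l => ?_) hab
  by_cases hl : l = j
  · subst hl
    change f l = g l
    rw [← hf, ← hg, hfg i hij]
  · exact hfg l hl

/-- A tuple that is not injective has two equal entries; the second bound is the union bound over at
most r² pairs of indices. -/
theorem card_embedding_bounds {α : Type*} [Fintype α] {r : ℕ} (S : Fin r → Finset α) :
    Nat.card {v : Fin r ↪ α // ∀ i, v i ∈ S i} ≤ ∏ i, (S i).card ∧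
      (∏ i, (S i).card) * Fintype.card α ≤
        Nat.card {v : Fin r ↪ α // ∀ i, v i ∈ S i} * Fintype.card α +
          r ^ 2 * Fintype.card α ^ r := by
  classical
  set P := Fintype.piFinset S with hP
  have hcard : Nat.card {v : Fin r ↪ α // ∀ i, v i ∈ S i} =
      (P.filter fun f => Function.Injective f).card := by
    rw [← Nat.card_eq_finsetCard]
    exact Nat.card_congr
      { toFun := fun v => ⟨v.1, by simpa [hP] using ⟨v.2, v.1.injective⟩⟩
        invFun := fun f => ⟨⟨f.1, (Finset.mem_filter.1 f.2).2⟩,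
          fun i => Fintype.mem_piFinset.1 (Finset.mem_filter.1 f.2).1 i⟩
        left_inv := fun _ => rfl
        right_inv := fun _ => rfl }
  rw [hcard, ← Fintype.card_piFinset, ← hP]
  refine ⟨Finset.card_filter_le _ _, ?_⟩
  set Q := (Finset.univ : Finset (Fin r × Fin r)).filter fun p => p.1 ≠ p.2
  have h1 : (P.filter fun f => ¬ Function.Injective f) ⊆
      Q.biUnion fun p => Finset.univ.filter fun f : Fin r → α => f p.1 = f p.2 := by
    intro f hf
    obtain ⟨i, j, h1, h2⟩ := Function.not_injective_iff.1 (Finset.mem_filter.1 hf).2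
    exact Finset.mem_biUnion.2 ⟨(i, j), by simpa [Q] using h2, by simpa using h1⟩
  have h2 : (P.filter fun f => ¬ Function.Injective f).card * Fintype.card α ≤
      r ^ 2 * Fintype.card α ^ r := by
    calc _ ≤ (∑ p ∈ Q, (Finset.univ.filter fun f : Fin r → α => f p.1 = f p.2).card) *
          Fintype.card α :=
          Nat.mul_le_mul_right _ ((Finset.card_le_card h1).trans Finset.card_biUnion_le)
      _ ≤ ∑ _p ∈ Q, Fintype.card α ^ r := by
          rw [Finset.sum_mul]
          exact Finset.sum_le_sum fun p hp => card_filter_eq_mul_card_le (Finset.mem_filter.1 hp).2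
      _ ≤ _ := by
          rw [Finset.sum_const, smul_eq_mul]
          refine Nat.mul_le_mul_right _ ((Finset.card_le_univ Q).trans ?_)
          simp [sq]
  rw [← Finset.card_filter_add_card_filter_not (s := P) (fun f => Function.Injective f), add_mul]
  omega

theorem tupleCount_bounds {n r : ℕ} (k : Fin r → ℕ) {T : PlaneTree}
    (hT : T ∈ increasingTrees (n + 1)) :
    |(T.tupleCount k : ℝ) - ∏ j, rankNumber (k j) (shape T.children)| * (n + 1) ≤
      r ^ 2 * (n + 1 : ℝ) ^ r := by
  classical
  obtain ⟨ts, hts, rfl⟩ := mem_increasingTrees_succ.1 hT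
  obtain ⟨hT1, hT2, hT3⟩ : node 1 ts ∈ increasingTreeSet (n + 1) := by
    simpa [increasingTrees] using hT
  set T := node 1 ts with hTdef
  set α := {x : ℕ // x ∈ T.labels}
  have hα : Fintype.card α = n + 1 := by
    rw [Fintype.card_of_subtype T.labels.toFinset fun x => List.mem_toFinset, hT3]
    simp
  set S : Fin r → Finset α := fun j => Finset.univ.filter fun x => T.HasRank x (k j) with hS
  have hcard : ∀ j, ((S j).card : ℝ) = rankNumber (k j) (shape ts) := by
    intro j
    have h1 : ((S j).map (Function.Embedding.subtype _) : Set ℕ) = rankSet (k j) [T] := by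
      ext x
      simp only [Finset.coe_map, Set.mem_image, Finset.mem_coe, hS, Finset.mem_filter,
        Finset.mem_univ, true_and, rankSet, List.mem_singleton, exists_eq_left, Set.mem_ofPred_eq]
      constructor
      · rintro ⟨y, hy, rfl⟩; exact hy
      · intro hx
        have hmem : x ∈ forestLabels [T] := rankSet_subset (k j) [T] ⟨T, by simp, hx⟩
        exact ⟨⟨x, by simpa [forestLabels] using hmem⟩, hx, rfl⟩
    -- In the one-tree forest `[T]` the root counts as a vertex too, which produces the extra term
    -- in `rankNumber`.
    have h2 := ncard_rankSet (k j) (ts := [T]) (by simpa [forestLabels] using hT2)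
    rw [← h1, Set.ncard_coe_finset, Finset.card_map] at h2
    rw [h2, hTdef, shape, shape, additive, additive, rankNumber]
    ring
  have hb := card_embedding_bounds S
  have hcount : T.tupleCount k = Nat.card {v : Fin r ↪ α // ∀ i, v i ∈ S i} := by
    rw [tupleCount]
    simp only [hS, Finset.mem_filter, Finset.mem_univ, true_and]
    rfl
  rw [← hcount, hα] at hb
  have hprod : ((∏ i, (S i).card : ℕ) : ℝ) = ∏ j, rankNumber (k j) (shape ts) := by
    push_cast; exact Finset.prod_congr rfl fun j _ => hcard j
  have h1 : (T.tupleCount k : ℝ) ≤ ∏ j, rankNumber (k j) (shape ts) := by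
    rw [← hprod]; exact_mod_cast hb.1
  have h2 : (∏ j, rankNumber (k j) (shape ts)) * (n + 1 : ℝ) ≤
      T.tupleCount k * (n + 1) + r ^ 2 * (n + 1 : ℝ) ^ r := by
    rw [← hprod]; exact_mod_cast hb.2
  change |_ - ∏ j, rankNumber (k j) (shape ts)| * _ ≤ _
  rw [abs_sub_comm, abs_of_nonneg (by linarith)]
  linarith

theorem exists_abs_expectedTupleCount_sub_le {r : ℕ} (k : Fin r → ℕ) :
    ∃ C : ℝ, ∀ n : ℕ, |expectedTupleCount (n + 1) k -
      (n + 1 : ℝ) ^ r * ∏ j, rankConst (k j)| * (n + 1) ≤ C * (n + 1 : ℝ) ^ r := by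
  obtain ⟨C, hC⟩ := exists_abs_growthMean_prod_sub_le k Finset.univ
  refine ⟨r ^ 2 + C, fun n => ?_⟩
  have hC := hC n
  rw [Finset.card_univ, Fintype.card_fin] at hC
  have hw : (0 : ℝ) < treeNumber n := by exact_mod_cast treeNumber_pos n
  have hN : (0 : ℝ) < n + 1 := by positivity
  set M := growthMean n (fun x => ∏ j, rankNumber (k j) x) with hM
  have h1 : expectedTupleCount (n + 1) k - M = (∑ T ∈ increasingTrees (n + 1),
      ((T.tupleCount k : ℝ) - ∏ j, rankNumber (k j) (shape T.children))) / treeNumber n := by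
    rw [Finset.sum_sub_distrib, sum_increasingTrees (fun x => ∏ j, rankNumber (k j) x), ← hM,
      expectedTupleCount, card_increasingTrees, sub_div, mul_div_cancel_left₀ _ hw.ne']
  have h2 : |expectedTupleCount (n + 1) k - M| * (n + 1) ≤ r ^ 2 * (n + 1 : ℝ) ^ r := by
    rw [h1, abs_div, abs_of_pos hw, div_mul_eq_mul_div, div_le_iff₀ hw]
    calc _ ≤ (∑ T ∈ increasingTrees (n + 1),
          |(T.tupleCount k : ℝ) - ∏ j, rankNumber (k j) (shape T.children)|) * (n + 1) :=
          mul_le_mul_of_nonneg_right (Finset.abs_sum_le_sum_abs _ _) hN.le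
      _ ≤ ∑ _T ∈ increasingTrees (n + 1), r ^ 2 * (n + 1 : ℝ) ^ r := by
          rw [Finset.sum_mul]
          exact Finset.sum_le_sum fun T hT => tupleCount_bounds k hT
      _ = _ := by rw [Finset.sum_const, card_increasingTrees, nsmul_eq_mul, mul_comm]
  have h3 := abs_sub_le (expectedTupleCount (n + 1) k) M ((n + 1 : ℝ) ^ r * ∏ j, rankConst (k j))
  have h4 := mul_le_mul_of_nonneg_right h3 hN.le
  rw [add_mul] at h4 ⊢
  linarith

end PlaneTree

-- The asymptotic formula

theorem theorem3p8 (r : ℕ) (k : Fin r → ℕ) :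
    ∃ δ : ℕ → ℝ, δ =O[Filter.atTop] (fun n : ℕ => ((n : ℝ))⁻¹) ∧
      ∀ n : ℕ, 1 ≤ n →
        PlaneTree.expectedTupleCount n k =
          (1 + δ n) * (n : ℝ) ^ r * ∏ j, PlaneTree.rankConst (k j) := by
  obtain ⟨C, hC⟩ := PlaneTree.exists_abs_expectedTupleCount_sub_le k
  set c := ∏ j, PlaneTree.rankConst (k j)
  have hc : 0 < c := Finset.prod_pos fun j _ => PlaneTree.rankConst_pos (k j)
  -- The relative error, well defined for n ≥ 1 because every `rankConst` is positive.
  refine ⟨fun n => (PlaneTree.expectedTupleCount n k - (n : ℝ) ^ r * c) / ((n : ℝ) ^ r * c),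
    ?_, fun n hn => ?_⟩
  · refine Asymptotics.IsBigO.of_bound (C / c) ?_
    filter_upwards [Filter.eventually_ge_atTop 1] with n hn
    obtain ⟨m, rfl⟩ : ∃ m, n = m + 1 := ⟨n - 1, by omega⟩
    have h := hC m
    push_cast
    have hN : (0 : ℝ) < m + 1 := by positivity
    have hP : (0 : ℝ) < (m + 1 : ℝ) ^ r * c := by positivity
    rw [Real.norm_eq_abs, Real.norm_eq_abs, abs_div, abs_of_pos hP, abs_of_pos (inv_pos.2 hN),
      div_le_iff₀ hP, ← mul_le_mul_iff_left₀ hN]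
    refine h.trans (le_of_eq ?_)
    field_simp
  · have hn' : (0 : ℝ) < n := by exact_mod_cast hn
    field_simp
    ring
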